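/- Let $n\ge 1$ be an integer, $\alpha\in(0,1)$ and $\theta>-\alpha$. **The variable $K_n$.** Let $V_1,V_2,\dots$ be independent with $V_i\sim\mathrm{Beta}(1-\alpha,\theta+i\alpha)$, and put $P_i=V_i\prod_{j<i}(1-V_j)$. Let $\mathrm{PD}(\alpha,\theta)$ be the law of the sequence $(P_i)_{i\ge1}$ rearranged in descending order. Let $X_1,\dots,X_n$ be a random sample from $\mathrm{PD}(\alpha,\theta)$; that is, conditionally on a random sequence $(P^{\downarrow}_i)_{i\ge1}$ with law $\mathrm{PD}(\alpha,\theta)$, the $X_l$ are i.i.d. with $\mathsf P[X_l=i\mid P^{\downarrow}]=P^{\downarrow}_i$. Let $K_n$ be the number of distinct values among $X_1,\dots,X_n$. **The variables $S_{\alpha,\theta}$ and $G_{\theta+n,1}$.** Let $f_\alpha$ be the density on $(0,\infty)$ of the positive $\alpha$-stable distribution, so that $\int_0^\infty e^{-\lambda x}f_\alpha(x)\,dx=e^{-\lambda^\alpha}$ for all $\lambda\ge0$. Let $S_{\alpha,\theta}$ be a random variable with density $$s\mapsto\frac{\Gamma(\theta+1)}{\alpha\,\Gamma(\theta/\alpha+1)}\,s^{\frac{\theta-1}{\alpha}-1}f_\alpha(s^{-1/\alpha}),\qquad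 s>0,$$ and let $G_{\theta+n,1}$ be a Gamma random variable with shape $\theta+n$ and scale $1$. **The variables $R(\alpha,n,z)$.** For $k\in\{1,\dots,n\}$ let $$\mathscr C(n,k;\alpha)=\frac1{k!}\sum_{i=1}^k(-1)^i\binom ki\prod_{m=0}^{n-1}(-i\alpha+m),$$ and let $\{R(\alpha,n,z)\}_{z>0}$ be a family of random variables, jointly measurable in $z$ and the random element that generates the family, with $$\mathsf P[R(\alpha,n,z)=k]=\frac{\mathscr C(n,k;\alpha)z^k}{\sum_{j=1}^n\mathscr C(n,j;\alpha)z^j},\qquad k\in\{1,\dots,n\}.$$ **Claim.** If $S_{\alpha,\theta}$, $G_{\theta+n,1}$ and the family $\{R(\alpha,n,z)\}_{z>0}$ are independent random elements, then $$K_n\stackrel{d}{=}R\big(\alpha,n,\,S_{\alpha,\theta}\,G_{\theta+n,1}^{\alpha}\big).$$ -/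

import Mathlib

open MeasureTheory ProbabilityTheory

namespace PitmanYor

/-! ### The two parameter Poisson-Dirichlet distribution and random samples from it -/

/-- Stick-breaking weights `P i = v i * ∏_{j < i} (1 - v j)` (indices start at `0`). -/
def stickBreaking (v : ℕ → ℝ) (i : ℕ) : ℝ :=
  v i * ∏ j ∈ Finset.range i, (1 - v j)

/-- The descending order statistics of a sequence of weights: `ranked p k` is the `(k+1)`-st
largest value, written as the supremum over all sets `s` of `k + 1` indices of `min_{i ∈ s} p i`. -/
noncomputable def ranked (p : ℕ → ℝ) (k : ℕ) : ℝ :=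
  ⨆ s : {s : Finset ℕ // s.card = k + 1},
    s.1.inf' (Finset.card_pos.mp (by rw [s.2]; exact Nat.succ_pos k)) p

/-- `PD(α, θ)`: the law of the ranked stick-breaking weights built from independent
`V_i ~ Beta(1 - α, θ + iα)`, `i ≥ 1` (here `V_{i+1}` has index `i`). -/
noncomputable def poissonDirichlet (α θ : ℝ) : Measure (ℕ → ℝ) :=
  (Measure.infinitePi fun i : ℕ => betaMeasure (1 - α) (θ + (i + 1) * α)).map
    fun v => ranked (stickBreaking v)

/-- `X_1, …, X_n` is a random sample from the random discrete distribution `P`: conditionally on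
`P`, the `X_i` are i.i.d. with `Prob[X_i = x | P] = P x`. -/
structure IsRandomSample {Ω : Type*} [MeasurableSpace Ω] {n : ℕ}
    (X : Fin n → Ω → ℕ) (P : Ω → ℕ → ℝ) (μ : Measure Ω) : Prop where
  measurable : ∀ i, Measurable (X i)
  joint : ∀ (x : Fin n → ℕ) (A : Set (ℕ → ℝ)), MeasurableSet A →
    μ {ω | P ω ∈ A ∧ ∀ i, X i ω = x i} =
      ∫⁻ ω in {ω | P ω ∈ A}, ∏ i, ENNReal.ofReal (P ω (x i)) ∂μ

/-- The number of blocks of the partition of the sample given by `i ∼ j ↔ X_i = X_j`, that is, the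
number of distinct values in the sample. -/
def numBlocks {Ω : Type*} {n : ℕ} (X : Fin n → Ω → ℕ) (ω : Ω) : ℕ :=
  (Finset.univ.image fun i => X i ω).card

/-! ### The scaled Mittag-Leffler distribution -/

/-- `f` is a density on `(0, ∞)` of the positive `α`-stable distribution, the probability
distribution with Laplace transform `l ↦ exp (-(l ^ α))`. (The case `l = 0` gives total mass one.
Only the values of `f` on `(0, ∞)` matter, and these are determined almost everywhere.) -/
structure IsPositiveStableDensity (α : ℝ) (f : ℝ → ℝ) : Prop where
  measurable : Measurable f
  nonneg : ∀ x, 0 ≤ f x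
  laplace : ∀ l : ℝ, 0 ≤ l →
    ∫ x in Set.Ioi (0 : ℝ), Real.exp (-(l * x)) * f x = Real.exp (-(l ^ α))

/-- The density of `S_{α,θ}` in terms of the positive stable density `f`. -/
noncomputable def scaledMittagLefflerPDF (α θ : ℝ) (f : ℝ → ℝ) (s : ℝ) : ℝ :=
  if 0 < s then
    Real.Gamma (θ + 1) / (α * Real.Gamma (θ / α + 1)) * s ^ ((θ - 1) / α - 1) *
      f (s ^ (-1 / α))
  else 0

/-- `S` has the scaled Mittag-Leffler distribution with parameters `α`, `θ`. -/
def HasScaledMittagLefflerLaw {Ω : Type*} [MeasurableSpace Ω] (α θ : ℝ) (S : Ω → ℝ)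
    (μ : Measure Ω) : Prop :=
  ∃ f, IsPositiveStableDensity α f ∧
    HasLaw S (volume.withDensity fun s => ENNReal.ofReal (scaledMittagLefflerPDF α θ f s)) μ

/-! ### The random variables `R(α, n, z)` -/

/-- The rising factorial `[x]_{(n,a)} = ∏_{0 ≤ i ≤ n - 1} (x + i a)`. -/
def risingFactorial (x : ℝ) (n : ℕ) (a : ℝ) : ℝ :=
  ∏ i ∈ Finset.range n, (x + i * a)

/-- The generalized factorial coefficients `𝒞(n, k; α)`. -/
noncomputable def genFactCoeff (n k : ℕ) (α : ℝ) : ℝ :=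
  1 / (k.factorial : ℝ) *
    ∑ i ∈ Finset.Icc 1 k, (-1 : ℝ) ^ i * (k.choose i : ℝ) * risingFactorial (-(i * α)) n 1

/-- The probability `ρ({k}; α, n, z)`. -/
noncomputable def rho (k : ℕ) (α : ℝ) (n : ℕ) (z : ℝ) : ℝ :=
  genFactCoeff n k α * z ^ k / ∑ j ∈ Finset.Icc 1 n, genFactCoeff n j α * z ^ j

/-- `R = {R z}` is a family of random variables on `Ω` with `Prob[R z = k] = ρ({k}; α, n, z)` for
`z > 0` and `k ∈ {1, …, n}`. As a random element it carries the information in the sub-σ-algebra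
`𝓡`, with respect to which `(z, ω) ↦ R z ω` is jointly measurable, so that a random variable may be
substituted for `z`. (The values at `z ≤ 0` play no role.) -/
structure IsRhoFamily {Ω : Type*} (𝓡 : MeasurableSpace Ω) [mΩ : MeasurableSpace Ω]
    (α : ℝ) (n : ℕ) (R : ℝ → Ω → ℕ) (μ : Measure Ω) : Prop where
  le : 𝓡 ≤ mΩ
  measurable : Measurable[(borel ℝ).prod 𝓡] fun q : ℝ × Ω => R q.1 q.2
  law : ∀ z : ℝ, 0 < z → ∀ k ∈ Finset.Icc 1 n, μ.real {ω | R z ω = k} = rho k α n z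

end PitmanYor

/-! Both variables have the explicit law `blockProb`, proportional in `k` to `genFactSum n k α * Γ(k
+ θ/α)`.

For the sample, the number of distinct values does not change when the weights are rearranged, so
ranking may be dropped (`blockSum_ranked`). Conditionally on the set of sample points that fall on
the first stick, the remaining points sample stick-breaking weights with `θ` replaced by `θ + α`
(`meanBlockSum_succ`), and `blockProb` obeys the same recursion (`blockProb_succ`). When the first
stick is missed, the sample size does not drop, so induction on `n` alone does not close. However,
the difference of the two solutions at `θ` equals `stickMoment α θ 0 n` times the difference at `θ +
α`. Iterating multiplies a bounded quantity by factors whose product tends to zero, because the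
harmonic series diverges (`meanBlockSum_eq`).

For the mixture, `S = T ^ (-α)` with `T` stable, tilted by `t ^ (-θ)`, so `S * G ^ α = W ^ α` with
`W = G / T`. The density of `W` involves the integral of `t ^ n * exp (-w * t)` against the stable
law, which is an `n`-th derivative of `exp (-(w ^ α))` up to sign. That derivative contains the
polynomial `∑ j, 𝒞(n, j; α) * (w ^ α) ^ j` (`expRpowDeriv_eq`), exactly the denominator of `rho` at
`z = w ^ α`. It cancels, and a Gamma integral remains (`lintegral_rho`). -/

namespace PitmanYor

/-! ### Generalized factorial coefficients and the candidate law -/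

section Combinatorics

open Finset

lemma risingFactorial_zero (x : ℝ) : risingFactorial x 0 1 = 1 := by simp [risingFactorial]

lemma risingFactorial_succ (x : ℝ) (n : ℕ) :
    risingFactorial x (n + 1) 1 = risingFactorial x n 1 * (x + n) := by
  simp [risingFactorial, prod_range_succ]

lemma risingFactorial_succ' (x : ℝ) (n : ℕ) :
    risingFactorial x (n + 1) 1 = x * risingFactorial (x + 1) n 1 := by
  simp only [risingFactorial, prod_range_succ']
  simp only [mul_one, Nat.cast_zero, add_zero, Nat.cast_add, Nat.cast_one]
  rw [mul_comm]
  congr 1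
  exact prod_congr rfl fun i _ => by ring

lemma risingFactorial_pos {x : ℝ} (hx : 0 < x) (n : ℕ) : 0 < risingFactorial x n 1 :=
  prod_pos fun i _ => by positivity

lemma Gamma_add_natCast {x : ℝ} (hx : 0 < x) (n : ℕ) :
    Real.Gamma (x + n) = risingFactorial x n 1 * Real.Gamma x := by
  induction n with
  | zero => simp [risingFactorial_zero]
  | succ n ih =>
    rw [Nat.cast_succ, ← add_assoc, Real.Gamma_add_one (by positivity), ih, risingFactorial_succ]
    ring

/-- The Chu-Vandermonde identity for rising factorials. -/
lemma sum_choose_mul_risingFactorial (x y : ℝ) (n : ℕ) :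
    ∑ ij ∈ antidiagonal n, (n.choose ij.1 : ℝ) *
      (risingFactorial x ij.1 1 * risingFactorial y ij.2 1) = risingFactorial (x + y) n 1 := by
  induction n with
  | zero => simp [risingFactorial_zero]
  | succ n ih =>
    rw [sum_antidiagonal_choose_succ_mul
      (fun i j => risingFactorial x i 1 * risingFactorial y j 1), risingFactorial_succ, ← ih,
      sum_mul, ← sum_add_distrib]
    refine sum_congr rfl fun ij hij => ?_
    have h := mem_antidiagonal.1 hij
    rw [Nat.choose_symm_of_eq_add h.symm, risingFactorial_succ, risingFactorial_succ, ← h]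
    push_cast
    ring

/-- The generalized factorial coefficients, with the term `i = 0` included, so that the recursions
also hold for `n = 0`. -/
noncomputable def genFactSum (n k : ℕ) (α : ℝ) : ℝ :=
  1 / (k.factorial : ℝ) *
    ∑ i ∈ range (k + 1), (-1 : ℝ) ^ i * (k.choose i : ℝ) * risingFactorial (-(i * α)) n 1

/-- The extra term `i = 0` carries the rising factorial of `0`, which vanishes once it has at least
one factor. -/
lemma genFactSum_succ_eq (n k : ℕ) (α : ℝ) : genFactSum (n + 1) k α = genFactCoeff (n + 1) k α := by
  rw [genFactSum, genFactCoeff, range_eq_Ico, sum_eq_sum_Ico_succ_bot (by omega)]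
  simp only [risingFactorial_succ', Nat.cast_zero, zero_mul, neg_zero, mul_zero, zero_add]
  rfl

lemma genFactSum_eq {n : ℕ} (hn : n ≠ 0) (k : ℕ) (α : ℝ) :
    genFactSum n k α = genFactCoeff n k α := by
  obtain ⟨n, rfl⟩ := Nat.exists_eq_succ_of_ne_zero hn
  exact genFactSum_succ_eq n k α

lemma genFactSum_zero_right (n : ℕ) (α : ℝ) :
    genFactSum n 0 α = if n = 0 then 1 else 0 := by
  cases n with
  | zero => simp [genFactSum, risingFactorial_zero]
  | succ n => simp [genFactSum, risingFactorial_succ']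

lemma genFactSum_zero_left (k : ℕ) (α : ℝ) :
    genFactSum 0 k α = if k = 0 then 1 else 0 := by
  have h := Int.alternating_sum_range_choose (n := k)
  have h' : ∑ i ∈ range (k + 1), (-1 : ℝ) ^ i * (k.choose i : ℝ) = if k = 0 then 1 else 0 := by
    exact_mod_cast h
  simp only [genFactSum, risingFactorial_zero, mul_one, h']
  split_ifs with hk <;> simp [hk]

/-- The weighted sum of generalized factorial coefficients over the size of a block. -/
lemma genFactSum_succ_succ_eq_sum (n k : ℕ) (α : ℝ) :
    genFactSum (n + 1) (k + 1) α = α * ∑ ij ∈ antidiagonal n, (n.choose ij.1 : ℝ) *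
      (risingFactorial (1 - α) ij.1 1 * genFactSum ij.2 k α) := by
  have h1 : ∑ ij ∈ antidiagonal n, (n.choose ij.1 : ℝ) *
      (risingFactorial (1 - α) ij.1 1 * genFactSum ij.2 k α) = 1 / (k.factorial : ℝ) *
      ∑ i ∈ range (k + 1), (-1 : ℝ) ^ i * (k.choose i : ℝ) *
        risingFactorial (1 - α + -(i * α)) n 1 := by
    simp only [← sum_choose_mul_risingFactorial, genFactSum, mul_sum]
    rw [sum_comm]
    refine sum_congr rfl fun i _ => sum_congr rfl fun ij _ => ?_
    ring
  rw [h1, genFactSum, sum_range_succ']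
  simp only [Nat.cast_zero, zero_mul, neg_zero, risingFactorial_succ' 0, mul_zero, add_zero,
    mul_sum]
  refine sum_congr rfl fun i _ => ?_
  -- Absorption turns the binomials of row `k + 1` into those of row `k`; the first factor `-(i + 1)
  -- * α` of the rising factorial supplies `α`, the sign and the factor `i + 1`.
  have h2 : ((k + 1).choose (i + 1) : ℝ) * (i + 1) = (k + 1) * k.choose i := by
    exact_mod_cast (Nat.add_one_mul_choose_eq k i).symm
  have h3 : (-(((i + 1 : ℕ) : ℝ) * α) + 1) = 1 - α + -(i * α) := by push_cast; ring
  rw [risingFactorial_succ', h3, Nat.factorial_succ, pow_succ]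
  have hk : (k.factorial : ℝ) ≠ 0 := by positivity
  have hk1 : (k : ℝ) + 1 ≠ 0 := by positivity
  push_cast
  field_simp
  linear_combination α * risingFactorial (1 - α + -(i * α)) n 1 * h2

/-- The triangular recursion. It drives the total mass of `blockProb` and the successive derivatives
of `exp (-(w ^ α))`. -/
lemma genFactSum_succ_succ (n k : ℕ) (α : ℝ) :
    genFactSum (n + 1) (k + 1) α =
      (n - (k + 1) * α) * genFactSum n (k + 1) α + α * genFactSum n k α := by
  -- All three coefficients are put over the same binomials and the same range, so that the
  -- recursion can be checked term by term; the added term `i = k + 1` is zero.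
  have h1 : genFactSum n k α = 1 / ((k + 1).factorial : ℝ) *
      ∑ i ∈ range (k + 2), (-1 : ℝ) ^ i * ((k + 1).choose i * ((k + 1) - i) : ℝ) *
        risingFactorial (-(i * α)) n 1 := by
    rw [sum_range_succ, genFactSum, mul_sum]
    simp only [Nat.cast_add, Nat.cast_one, sub_self, mul_zero, zero_mul, add_zero, mul_sum]
    refine sum_congr rfl fun i hi => ?_
    have hi' : i ≤ k := by simpa [Nat.lt_succ_iff] using hi
    have h2 : ((k + 1).choose i : ℝ) * ((k + 1) - i) = (k + 1) * k.choose i := by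
      have := Nat.choose_mul_succ_eq k i
      have h3 : ((k + 1 - i : ℕ) : ℝ) = (k + 1) - i := by
        rw [Nat.cast_sub (by omega)]; push_cast; ring
      rw [← h3]
      exact_mod_cast (by linarith : (k + 1).choose i * (k + 1 - i) = (k + 1) * k.choose i)
    rw [h2, Nat.factorial_succ]
    have hk : (k.factorial : ℝ) ≠ 0 := by positivity
    push_cast
    field_simp
  rw [h1, genFactSum, genFactSum, mul_left_comm, mul_left_comm α, ← mul_add]
  congr 1
  rw [mul_sum, mul_sum, ← sum_add_distrib]
  refine sum_congr rfl fun i _ => ?_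
  rw [risingFactorial_succ]
  ring

lemma genFactSum_eq_zero_of_lt {n k : ℕ} (h : n < k) (α : ℝ) : genFactSum n k α = 0 := by
  induction n generalizing k with
  | zero => rw [genFactSum_zero_left, if_neg (by omega)]
  | succ n ih =>
    obtain ⟨k, rfl⟩ := Nat.exists_eq_add_of_lt (Nat.zero_lt_of_lt h)
    rw [zero_add, genFactSum_succ_succ, ih (by omega), ih (by omega)]
    simp

/-- The alternating sum hides the sign; the convolution over block sizes has nonnegative weights
because `1 - α > 0`. -/
lemma genFactSum_nonneg (n k : ℕ) {α : ℝ} (hα0 : 0 < α) (hα1 : α < 1) :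
    0 ≤ genFactSum n k α := by
  induction n using Nat.strong_induction_on generalizing k with
  | _ n ih =>
    cases n with
    | zero => rw [genFactSum_zero_left]; split_ifs <;> simp
    | succ n =>
      cases k with
      | zero => simp [genFactSum_zero_right]
      | succ k =>
        rw [genFactSum_succ_succ_eq_sum]
        refine mul_nonneg hα0.le (sum_nonneg fun ij hij => ?_)
        have h := mem_antidiagonal.1 hij
        exact mul_nonneg (by positivity)
          (mul_nonneg (risingFactorial_pos (by linarith) _).le (ih _ (by omega) _))

lemma genFactSum_one_pos (n : ℕ) {α : ℝ} (hα0 : 0 < α) (hα1 : α < 1) :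
    0 < genFactSum (n + 1) 1 α := by
  induction n with
  | zero => simp [genFactSum_succ_succ, genFactSum_zero_left, hα0]
  | succ n ih =>
    rw [genFactSum_succ_succ, genFactSum_zero_right, if_neg (by omega)]
    have : α < (n + 1 : ℕ) := by push_cast; linarith [(n.cast_nonneg : (0 : ℝ) ≤ n)]
    simp only [CharP.cast_eq_zero, zero_add, one_mul, mul_zero, add_zero]
    exact mul_pos (by linarith) ih

/-- The probability that a sample of size `n` from `PD(α, θ)` has `k` distinct values. -/
noncomputable def blockProb (n k : ℕ) (α θ : ℝ) : ℝ :=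
  genFactSum n k α * (Real.Gamma (θ + 1) * Real.Gamma (k + θ / α)) /
    (α * Real.Gamma (θ / α + 1) * Real.Gamma (θ + n))

/-- The mixed moments of a beta distribution with parameters `1 - α` and `θ + α`. -/
noncomputable def stickMoment (α θ : ℝ) (m l : ℕ) : ℝ :=
  beta (1 - α + m) (θ + α + l) / beta (1 - α) (θ + α)

/-- The factor `Γ(θ + α + l)` cancels between the beta moment and the law at `θ + α`. The Gamma
quotient that is left depends on `m` and `l` only through `m + l`, so it factors out of sums over an
antidiagonal. -/
lemma stickMoment_mul_blockProb {α θ : ℝ} (hα0 : 0 < α) (hα1 : α < 1) (hθ : -α < θ) (m l k : ℕ) :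
    stickMoment α θ m l * blockProb l k α (θ + α) =
      risingFactorial (1 - α) m 1 * genFactSum l k α *
        (Real.Gamma (θ + 1) * Real.Gamma (k + 1 + θ / α) /
          (Real.Gamma (θ + 1 + (m + l : ℕ)) * Real.Gamma (θ / α + 1))) := by
  have h1 : 0 < θ + α := by linarith
  have h2 : 0 < θ / α + 1 := by
    rw [show θ / α + 1 = (θ + α) / α by field_simp]; positivity
  have h3 : 0 < θ + 1 := by linarith
  have e1 : (k : ℝ) + (θ + α) / α = k + 1 + θ / α := by field_simp; ring
  have e2 : (θ + α) / α + 1 = (θ / α + 1) + 1 := by field_simp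
  have e3 : 1 - α + m + (θ + α + l) = θ + 1 + (m + l : ℕ) := by push_cast; ring
  have e4 : 1 - α + (θ + α) = θ + 1 := by ring
  rw [stickMoment, blockProb, beta, beta, e1, e2, e3, e4, Real.Gamma_add_one h1.ne',
    Real.Gamma_add_one h2.ne', Gamma_add_natCast (by linarith : 0 < 1 - α)]
  have g1 := (Real.Gamma_pos_of_pos h1).ne'
  have g2 := (Real.Gamma_pos_of_pos h2).ne'
  have g3 := (Real.Gamma_pos_of_pos h3).ne'
  have g4 := (Real.Gamma_pos_of_pos (by linarith : 0 < 1 - α)).ne'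
  have g5 := (Real.Gamma_pos_of_pos (by positivity : 0 < θ + 1 + ((m + l : ℕ) : ℝ))).ne'
  have g6 := (Real.Gamma_pos_of_pos (by positivity : 0 < θ + α + l)).ne'
  have h4 : α * (θ / α + 1) = θ + α := by field_simp
  have h5 := h1.ne'
  generalize Real.Gamma (θ + α) = x1 at *
  generalize Real.Gamma (θ / α + 1) = x2 at *
  generalize Real.Gamma (θ + 1) = x3 at *
  generalize Real.Gamma (1 - α) = x4 at *
  generalize Real.Gamma (θ + 1 + ((m + l : ℕ) : ℝ)) = x5 at *
  generalize Real.Gamma (θ + α + l) = x6 at *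
  generalize Real.Gamma (k + 1 + θ / α) = x7 at *
  rw [← mul_assoc α, h4]
  field_simp

/-- The recursion for `blockProb` obtained by conditioning on the block of the first atom. -/
lemma blockProb_succ {α θ : ℝ} (hα0 : 0 < α) (hα1 : α < 1) (hθ : -α < θ) {n : ℕ} (hn : n ≠ 0)
    (k : ℕ) :
    blockProb n (k + 1) α θ = stickMoment α θ 0 n * blockProb n (k + 1) α (θ + α)
      - stickMoment α θ 0 n * blockProb n k α (θ + α)
      + ∑ ij ∈ antidiagonal n, (n.choose ij.1 : ℝ) *
        (stickMoment α θ ij.1 ij.2 * blockProb ij.2 k α (θ + α)) := by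
  -- The full antidiagonal includes the empty block `(0, n)`, counted with `k` instead of `k + 1`;
  -- the two terms in front of the sum correct this. The complete sum is one coefficient of order `n
  -- + 1`.
  have h0 : ∑ ij ∈ antidiagonal n, (n.choose ij.1 : ℝ) *
        (stickMoment α θ ij.1 ij.2 * blockProb ij.2 k α (θ + α)) =
      genFactSum (n + 1) (k + 1) α / α * (Real.Gamma (θ + 1) * Real.Gamma (k + 1 + θ / α) /
          (Real.Gamma (θ + 1 + n) * Real.Gamma (θ / α + 1))) := by
    rw [genFactSum_succ_succ_eq_sum, mul_div_cancel_left₀ _ hα0.ne', sum_mul]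
    refine sum_congr rfl fun ij hij => ?_
    rw [stickMoment_mul_blockProb hα0 hα1 hθ, mem_antidiagonal.1 hij]
    ring
  have hn1 : (1 : ℝ) ≤ n := by exact_mod_cast Nat.one_le_iff_ne_zero.2 hn
  have h2 : 0 < θ / α + 1 := by
    rw [show θ / α + 1 = (θ + α) / α by field_simp]
    exact div_pos (by linarith) hα0
  have h6 : 0 < k + 1 + θ / α := by linarith [(k.cast_nonneg : (0 : ℝ) ≤ k)]
  have h7 : 0 < θ + n := by linarith
  rw [h0, stickMoment_mul_blockProb hα0 hα1 hθ, stickMoment_mul_blockProb hα0 hα1 hθ,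
    genFactSum_succ_succ, blockProb, risingFactorial_zero, zero_add]
  push_cast
  rw [show (k : ℝ) + 1 + 1 + θ / α = (k + 1 + θ / α) + 1 by ring, Real.Gamma_add_one h6.ne',
    show θ + 1 + (n : ℝ) = (θ + n) + 1 by ring, Real.Gamma_add_one h7.ne']
  have g2 := (Real.Gamma_pos_of_pos h2).ne'
  have g3 := (Real.Gamma_pos_of_pos h7).ne'
  have h4 : α * (k + 1 + θ / α) = k * α + α + θ := by field_simp
  have h8 : θ / α = (k * α + α + θ) / α - (k + 1) := by field_simp; ring
  generalize Real.Gamma (θ / α + 1) = x2 at *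
  generalize Real.Gamma (θ + 1) = x3 at *
  generalize Real.Gamma (θ + n) = x5 at *
  generalize Real.Gamma (k + 1 + θ / α) = x7 at *
  generalize genFactSum n (k + 1) α = c1
  generalize genFactSum n k α = c0
  field_simp
  ring

/-- The values of `blockProb` sum to one. -/
lemma sum_blockProb {α θ : ℝ} (hα0 : 0 < α) (hθ : -α < θ) (hα1 : α < 1) (n : ℕ) :
    ∑ k ∈ range (n + 1), blockProb (n + 1) (k + 1) α θ = 1 := by
  have h2 : 0 < θ / α + 1 := by
    rw [show θ / α + 1 = (θ + α) / α by field_simp]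
    exact div_pos (by linarith) hα0
  have g2 := (Real.Gamma_pos_of_pos h2).ne'
  have g3 := (Real.Gamma_pos_of_pos (by linarith : 0 < θ + 1)).ne'
  have key : ∀ N : ℕ, ∑ k ∈ range (N + 1), genFactSum (N + 1) (k + 1) α *
      Real.Gamma (((k + 1 : ℕ) : ℝ) + θ / α) * Real.Gamma (θ + 1) =
      α * Real.Gamma (θ / α + 1) * Real.Gamma (θ + (N + 1 : ℕ)) := by
    intro N
    induction N with
    | zero =>
      simp [genFactSum_succ_succ, genFactSum_zero_left, add_comm]
    | succ N ih =>
      have h7 : 0 < θ + ((N + 1 : ℕ) : ℝ) := by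
        push_cast; linarith [(N.cast_nonneg : (0 : ℝ) ≤ N)]
      have e1 : θ + ((N + 1 + 1 : ℕ) : ℝ) = (θ + ((N + 1 : ℕ) : ℝ)) + 1 := by push_cast; ring
      have e2 : ∀ k : ℕ, Real.Gamma (((k + 1 + 1 : ℕ) : ℝ) + θ / α) =
          (k + 1 + θ / α) * Real.Gamma (((k + 1 : ℕ) : ℝ) + θ / α) := fun k => by
        rw [show ((k + 1 + 1 : ℕ) : ℝ) + θ / α = (k + 1 + θ / α) + 1 by push_cast; ring,
          Real.Gamma_add_one (by linarith [(k.cast_nonneg : (0 : ℝ) ≤ k)])]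
        push_cast
        rfl
      rw [e1, Real.Gamma_add_one h7.ne', mul_left_comm, ← ih, mul_sum]
      have e3 : ∀ k : ℕ, genFactSum (N + 1 + 1) (k + 1) α *
          Real.Gamma (((k + 1 : ℕ) : ℝ) + θ / α) * Real.Gamma (θ + 1) =
          (((N + 1 : ℕ) : ℝ) - (k + 1) * α) * genFactSum (N + 1) (k + 1) α *
            Real.Gamma (((k + 1 : ℕ) : ℝ) + θ / α) * Real.Gamma (θ + 1) +
          α * genFactSum (N + 1) k α *
            Real.Gamma (((k + 1 : ℕ) : ℝ) + θ / α) * Real.Gamma (θ + 1) := fun k => by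
        rw [genFactSum_succ_succ]; ring
      simp only [e3, sum_add_distrib]
      -- Shifting the second sum by one pairs the coefficients: `N + 1 - (k + 1) * α + α * (k + 1 +
      -- θ / α) = θ + (N + 1)`, independent of `k`.
      rw [sum_range_succ, sum_range_succ' (fun k => α * genFactSum (N + 1) k α *
        Real.Gamma (((k + 1 : ℕ) : ℝ) + θ / α) * Real.Gamma (θ + 1)),
        genFactSum_eq_zero_of_lt (by omega : N + 1 < N + 1 + 1), genFactSum_zero_right,
        if_neg (by omega)]
      simp only [mul_zero, zero_mul, add_zero]
      rw [← sum_add_distrib]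
      refine sum_congr rfl fun k _ => ?_
      rw [e2]
      field_simp
      push_cast
      ring
  have h7 : 0 < θ + ((n + 1 : ℕ) : ℝ) := by
    push_cast; linarith [(n.cast_nonneg : (0 : ℝ) ≤ n)]
  have g4 := (Real.Gamma_pos_of_pos h7).ne'
  simp only [blockProb, ← sum_div]
  rw [div_eq_one_iff_eq (by positivity), ← key]
  exact sum_congr rfl fun k _ => by ring

lemma blockProb_nonneg {α θ : ℝ} (hα0 : 0 < α) (hα1 : α < 1) (hθ : -α < θ) {n : ℕ} (hn : n ≠ 0)
    (k : ℕ) : 0 ≤ blockProb n k α θ := by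
  have h2 : 0 < θ / α + 1 := by
    rw [show θ / α + 1 = (θ + α) / α by field_simp]
    exact div_pos (by linarith) hα0
  cases k with
  | zero => simp [blockProb, genFactSum_zero_right, hn]
  | succ k =>
    have hn1 : (1 : ℝ) ≤ n := by exact_mod_cast Nat.one_le_iff_ne_zero.2 hn
    have h3 : 0 < θ + n := by linarith
    have h4 : 0 < ((k + 1 : ℕ) : ℝ) + θ / α := by
      push_cast; linarith [(k.cast_nonneg : (0 : ℝ) ≤ k)]
    have h5 : 0 < θ + 1 := by linarith
    exact div_nonneg (mul_nonneg (genFactSum_nonneg n _ hα0 hα1)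
      (mul_pos (Real.Gamma_pos_of_pos h5) (Real.Gamma_pos_of_pos h4)).le)
      (mul_pos (mul_pos hα0 (Real.Gamma_pos_of_pos h2)) (Real.Gamma_pos_of_pos h3)).le

lemma blockProb_le_one {α θ : ℝ} (hα0 : 0 < α) (hα1 : α < 1) (hθ : -α < θ) {n : ℕ} (hn : n ≠ 0)
    (k : ℕ) : blockProb n k α θ ≤ 1 := by
  obtain ⟨n, rfl⟩ := Nat.exists_eq_succ_of_ne_zero hn
  cases k with
  | zero => simp [blockProb, genFactSum_zero_right]
  | succ k =>
    by_cases hk : k ∈ range (n + 1)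
    · rw [← sum_blockProb hα0 hθ hα1 n]
      exact single_le_sum (f := fun k => blockProb (n + 1) (k + 1) α θ)
        (fun i _ => blockProb_nonneg hα0 hα1 hθ hn _) hk
    · rw [blockProb, genFactSum_eq_zero_of_lt (by simpa using hk)]
      simp

/-- Positivity of `θ` is needed here: the formula contains `Γ(θ)` when the sample is empty. -/
lemma blockProb_zero_left {α θ : ℝ} (hα0 : 0 < α) (hθ : 0 < θ) (k : ℕ) :
    blockProb 0 k α θ = if k = 0 then 1 else 0 := by
  rw [blockProb, genFactSum_zero_left]
  split_ifs with hk
  · have g1 := (Real.Gamma_pos_of_pos hθ).ne'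
    have g2 := (Real.Gamma_pos_of_pos (div_pos hθ hα0)).ne'
    rw [hk, Nat.cast_zero, zero_add, add_zero, Real.Gamma_add_one hθ.ne',
      Real.Gamma_add_one (div_pos hθ hα0).ne']
    field_simp
  · simp

end Combinatorics

end PitmanYor

namespace PitmanYor

/-! ### Distinct values in a sample from fixed weights -/

section BlockSum

open Finset
open scoped ENNReal

variable {ι κ : Type} [Fintype ι] [Fintype κ]

/-- The probability that an i.i.d. sample indexed by `ι` from the weights `p` takes exactly `k`
distinct values. -/
noncomputable def blockSum (ι : Type) [Fintype ι] (k : ℕ) (p : ℕ → ℝ) : ℝ≥0∞ :=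
  ∑' x : ι → ℕ, if (univ.image x).card = k then ∏ i, ENNReal.ofReal (p (x i)) else 0

lemma measurable_blockSum (k : ℕ) : Measurable (blockSum ι k) := by
  unfold blockSum
  refine Measurable.tsum fun x => ?_
  split_ifs
  · fun_prop
  · fun_prop

lemma blockSum_congr (e : ι ≃ κ) (k : ℕ) (p : ℕ → ℝ) : blockSum ι k p = blockSum κ k p := by
  rw [blockSum, blockSum, ← (Equiv.arrowCongr e (Equiv.refl ℕ)).tsum_eq]
  refine tsum_congr fun x => ?_
  have h1 : (univ.image x) = univ.image (Equiv.arrowCongr e (Equiv.refl ℕ) x) := by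
    ext j
    simp only [mem_image, mem_univ, true_and, Equiv.arrowCongr_apply, Equiv.coe_refl,
      Function.comp_apply, id]
    exact ⟨fun ⟨a, ha⟩ => ⟨e a, by simpa using ha⟩, fun ⟨a, ha⟩ => ⟨e.symm a, ha⟩⟩
  have h2 : ∏ i, ENNReal.ofReal (p (x i)) =
      ∏ i, ENNReal.ofReal (p (Equiv.arrowCongr e (Equiv.refl ℕ) x i)) :=
    Fintype.prod_equiv e _ _ fun i => by simp
  rw [h1, h2]

lemma blockSum_of_isEmpty [IsEmpty ι] (k : ℕ) (p : ℕ → ℝ) :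
    blockSum ι k p = if k = 0 then 1 else 0 := by
  simp [blockSum, eq_comm]

lemma blockSum_zero [Nonempty ι] (p : ℕ → ℝ) : blockSum ι 0 p = 0 := by
  simp [blockSum, univ_nonempty.ne_empty]

/-- Relabelling the values permutes the samples and keeps the number of distinct values. This is
what makes the ranking in `poissonDirichlet` harmless. -/
lemma blockSum_comp_equiv (σ : ℕ ≃ ℕ) (k : ℕ) (p : ℕ → ℝ) :
    blockSum ι k (p ∘ σ) = blockSum ι k p := by
  rw [blockSum, blockSum, ← (Equiv.arrowCongr (Equiv.refl ι) σ.symm).tsum_eq]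
  refine tsum_congr fun x => ?_
  have h1 : univ.image (Equiv.arrowCongr (Equiv.refl ι) σ.symm x) =
      (univ.image x).image σ.symm := by
    rw [image_image]; rfl
  rw [h1, card_image_of_injective _ σ.symm.injective]
  simp

lemma blockSum_le_one (k : ℕ) {p : ℕ → ℝ}
    (hp : ∀ N, ∑ i ∈ range N, ENNReal.ofReal (p i) ≤ 1) : blockSum ι k p ≤ 1 := by
  classical
  rw [blockSum, ENNReal.tsum_eq_iSup_sum]
  refine iSup_le fun s => ?_
  -- Finitely many samples fit in a cube, over which the sum of products is a product of partial
  -- sums.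
  obtain ⟨N, hN⟩ : ∃ N, ∀ x ∈ s, ∀ i, x i < N := by
    refine ⟨(s.sup fun x => univ.sup x) + 1, fun x hx i => Nat.lt_succ_of_le ?_⟩
    exact (le_sup (f := x) (mem_univ i)).trans (le_sup (f := fun x : ι → ℕ => univ.sup x) hx)
  calc ∑ x ∈ s, (if (univ.image x).card = k then ∏ i, ENNReal.ofReal (p (x i)) else 0)
      ≤ ∑ x ∈ s, ∏ i, ENNReal.ofReal (p (x i)) :=
        sum_le_sum fun x _ => by split_ifs <;> simp
    _ ≤ ∑ x ∈ Fintype.piFinset fun _ : ι => range N, ∏ i, ENNReal.ofReal (p (x i)) :=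
        sum_le_sum_of_subset fun x hx => by simpa using hN x hx
    _ = ∏ _i : ι, ∑ j ∈ range N, ENNReal.ofReal (p j) :=
        (prod_univ_sum (fun _ : ι => range N) fun _ j => ENNReal.ofReal (p j)).symm
    _ ≤ 1 := prod_le_one' fun _ _ => hp N

variable [DecidableEq ι]

/-- The function with zero set `A` and values `y + 1` elsewhere. -/
def zeroOn (q : Σ A : Finset ι, {i // i ∉ A} → ℕ) (i : ι) : ℕ :=
  if h : i ∈ q.1 then 0 else q.2 ⟨i, h⟩ + 1

lemma zeroOn_bijective : Function.Bijective (zeroOn (ι := ι)) := by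
  constructor
  · rintro ⟨A, y⟩ ⟨B, z⟩ h
    have hAB : A = B := by
      ext i
      have := congrFun h i
      simp only [zeroOn] at this
      by_cases h1 : i ∈ A <;> by_cases h2 : i ∈ B <;> simp_all
    subst hAB
    congr 1
    funext ⟨i, hi⟩
    have := congrFun h i
    simpa [zeroOn, hi] using this
  · intro x
    refine ⟨⟨univ.filter fun i => x i = 0, fun i => x i - 1⟩, ?_⟩
    funext i
    by_cases h : x i = 0
    · simp [zeroOn, h]
    · simp [zeroOn, h]; omega

lemma card_image_zeroOn (A : Finset ι) (y : {i // i ∉ A} → ℕ) :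
    (univ.image (zeroOn ⟨A, y⟩)).card = (if A = ∅ then 0 else 1) + (univ.image y).card := by
  have h : univ.image (zeroOn ⟨A, y⟩) =
      (if A = ∅ then ∅ else {0}) ∪ (univ.image y).image Nat.succ := by
    ext j
    simp only [mem_image, mem_univ, true_and, mem_union]
    constructor
    · rintro ⟨i, rfl⟩
      by_cases hi : i ∈ A
      · left
        rw [if_neg (ne_empty_of_mem hi)]
        simp [zeroOn, hi]
      · right
        exact ⟨y ⟨i, hi⟩, ⟨_, rfl⟩, by simp [zeroOn, hi]⟩
    · rintro (h | ⟨_, ⟨⟨i, hi⟩, rfl⟩, rfl⟩)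
      · split_ifs at h with hA
        · simp at h
        · obtain ⟨i, hi⟩ := nonempty_iff_ne_empty.2 hA
          exact ⟨i, by simp_all [zeroOn]⟩
      · exact ⟨i, by simp [zeroOn, hi]⟩
  rw [h, card_union_of_disjoint, card_image_of_injective _ Nat.succ_injective]
  · split_ifs <;> simp
  · split_ifs <;> simp [disjoint_left]

/-- Samples are split by the set `A` of indices that hit the atom `0`. A nonempty `A` uses up one
distinct value, an empty one none. -/
lemma blockSum_succ {p p' : ℕ → ℝ} {v w : ℝ} (hw : 0 ≤ w) (h0 : p 0 = v)
    (hs : ∀ i, p (i + 1) = w * p' i) (k : ℕ) :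
    blockSum ι (k + 1) p = ∑ A : Finset ι, ENNReal.ofReal v ^ A.card *
      ENNReal.ofReal w ^ Fintype.card {i // i ∉ A} *
        blockSum {i // i ∉ A} (if A = ∅ then k + 1 else k) p' := by
  rw [blockSum, ← (Equiv.ofBijective _ (zeroOn_bijective (ι := ι))).tsum_eq, ENNReal.tsum_sigma',
    tsum_fintype]
  refine sum_congr rfl fun A _ => ?_
  rw [blockSum, ← ENNReal.tsum_mul_left]
  refine tsum_congr fun y => ?_
  rw [Equiv.ofBijective_apply, card_image_zeroOn]
  have h1 : (if A = ∅ then 0 else 1) + (univ.image y).card = k + 1 ↔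
      (univ.image y).card = if A = ∅ then k + 1 else k := by
    split_ifs <;> omega
  simp only [h1, mul_ite, mul_zero]
  congr 1
  rw [← Fintype.prod_subtype_mul_prod_subtype (fun i => i ∈ A)]
  have e1 : ∀ i : {i // i ∈ A}, ENNReal.ofReal (p (zeroOn ⟨A, y⟩ i)) = ENNReal.ofReal v :=
    fun i => by simp [zeroOn, i.2, h0]
  have e2 : ∀ i : {i // i ∉ A}, ENNReal.ofReal (p (zeroOn ⟨A, y⟩ i)) =
      ENNReal.ofReal w * ENNReal.ofReal (p' (y i)) :=
    fun i => by simp [zeroOn, i.2, hs, ENNReal.ofReal_mul hw]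
  simp only [e1, e2, prod_const, prod_mul_distrib, card_univ, Fintype.card_coe, mul_assoc]

end BlockSum

/-! ### Stick-breaking weights and the recursion in the first stick -/

section StickBreaking

open Finset
open scoped ENNReal

/-- Prepending a value to a sequence. -/
def consSeq (q : ℝ × (ℕ → ℝ)) : ℕ → ℝ
  | 0 => q.1
  | i + 1 => q.2 i

lemma measurable_consSeq : Measurable consSeq := by
  refine measurable_pi_lambda _ fun i => ?_
  cases i with
  | zero => exact measurable_fst
  | succ i => exact (measurable_pi_apply i).comp measurable_snd

lemma map_consSeq_prod_infinitePi (ν : ℕ → Measure ℝ) [∀ i, IsProbabilityMeasure (ν i)] :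
    ((ν 0).prod (Measure.infinitePi fun i => ν (i + 1))).map consSeq = Measure.infinitePi ν := by
  classical
  refine Measure.eq_infinitePi ν fun s t ht => ?_
  -- Padding with `univ` replaces the index set `s` by an initial segment, which splits into its
  -- head and its shifted tail.
  set u : ℕ → Set ℝ := fun i => if i ∈ s then t i else Set.univ with hu
  have hum : ∀ i, MeasurableSet (u i) := fun i => by
    simp only [hu]; split_ifs
    · exact ht i
    · exact .univ
  obtain ⟨N, hN⟩ : ∃ N, ∀ i ∈ s, i < N + 1 :=
    ⟨s.sup id, fun i hi => Nat.lt_succ_of_le (le_sup (f := id) hi)⟩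
  have h1 : consSeq ⁻¹' (Set.pi (s : Set ℕ) t) =
      u 0 ×ˢ Set.pi (range N : Set ℕ) (fun i => u (i + 1)) := by
    ext q
    simp only [Set.mem_preimage, Set.mem_pi, Finset.mem_coe, Set.mem_prod, mem_range, hu]
    constructor
    · intro h
      refine ⟨?_, fun i _ => ?_⟩
      · split_ifs with h0
        · exact h 0 h0
        · trivial
      · split_ifs with h0
        · exact h _ h0
        · trivial
    · rintro ⟨h, h'⟩ i hi
      cases i with
      | zero => simpa [hi, consSeq] using h
      | succ i => simpa [hi, consSeq] using h' i (by have := hN _ hi; omega)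
  rw [Measure.map_apply measurable_consSeq (MeasurableSet.pi s.countable_toSet fun i _ => ht i), h1,
    Measure.prod_prod, Measure.infinitePi_pi _ fun i _ => hum (i + 1), mul_comm,
    ← prod_range_succ' (fun i => ν i (u i))]
  have h2 : s ⊆ range (N + 1) := fun i hi => mem_range.2 (hN i hi)
  rw [← prod_subset h2 fun i _ hi => by simp [hu, hi]]
  exact prod_congr rfl fun i hi => by simp [hu, hi]

/-- The law of the stick-breaking fractions. -/
noncomputable def stickMeasure (α θ : ℝ) : Measure (ℕ → ℝ) :=
  Measure.infinitePi fun i : ℕ => betaMeasure (1 - α) (θ + (i + 1) * α)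

variable {α θ : ℝ}

lemma isProbabilityMeasure_stick (hα0 : 0 < α) (hα1 : α < 1) (hθ : -α < θ) (i : ℕ) :
    IsProbabilityMeasure (betaMeasure (1 - α) (θ + (i + 1) * α)) :=
  isProbabilityMeasureBeta (by linarith)
    (by nlinarith [mul_nonneg (i.cast_nonneg : (0 : ℝ) ≤ i) hα0.le])

lemma ae_betaMeasure (a b : ℝ) : ∀ᵐ v ∂betaMeasure a b, v ∈ Set.Ioo (0 : ℝ) 1 := by
  rw [betaMeasure, ae_withDensity_iff (by unfold betaPDF; fun_prop)]
  refine Filter.Eventually.of_forall fun v hv => ?_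
  by_contra h
  apply hv
  rw [betaPDF_eq, if_neg (by simpa using h), ENNReal.ofReal_zero]

lemma ae_stickMeasure (hα0 : 0 < α) (hα1 : α < 1) (hθ : -α < θ) :
    ∀ᵐ v ∂stickMeasure α θ, ∀ i, v i ∈ Set.Ioo (0 : ℝ) 1 := by
  have := isProbabilityMeasure_stick hα0 hα1 hθ
  refine ae_all_iff.2 fun i => ?_
  have h := measurePreserving_eval_infinitePi
    (fun i : ℕ => betaMeasure (1 - α) (θ + (i + 1) * α)) i
  exact h.quasiMeasurePreserving.ae (ae_betaMeasure _ _)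

lemma measurable_stickBreaking : Measurable stickBreaking := by
  unfold stickBreaking
  fun_prop

lemma sum_stickBreaking (v : ℕ → ℝ) (N : ℕ) :
    ∑ i ∈ range N, stickBreaking v i = 1 - ∏ j ∈ range N, (1 - v j) := by
  induction N with
  | zero => simp
  | succ N ih => rw [sum_range_succ, ih, prod_range_succ, stickBreaking]; ring

lemma stickBreaking_pos {v : ℕ → ℝ} (hv : ∀ i, v i ∈ Set.Ioo (0 : ℝ) 1) (i : ℕ) :
    0 < stickBreaking v i :=
  mul_pos (hv i).1 (prod_pos fun j _ => by linarith [(hv j).2])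

lemma sum_stickBreaking_le_one {v : ℕ → ℝ} (hv : ∀ i, v i ∈ Set.Ioo (0 : ℝ) 1) (N : ℕ) :
    ∑ i ∈ range N, stickBreaking v i ≤ 1 := by
  rw [sum_stickBreaking]
  linarith [prod_nonneg fun j (_ : j ∈ range N) => (by linarith [(hv j).2] : 0 ≤ 1 - v j)]

lemma stickBreaking_consSeq_succ (q : ℝ × (ℕ → ℝ)) (i : ℕ) :
    stickBreaking (consSeq q) (i + 1) = (1 - q.1) * stickBreaking q.2 i := by
  simp only [stickBreaking, prod_range_succ', consSeq]
  ring

lemma lintegral_betaMeasure {a b : ℝ} (ha : 0 < a) (hb : 0 < b) (m l : ℕ) :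
    ∫⁻ v, ENNReal.ofReal v ^ m * ENNReal.ofReal (1 - v) ^ l ∂betaMeasure a b =
      ENNReal.ofReal (beta (a + m) (b + l) / beta a b) := by
  have ham : 0 < a + m := by positivity
  have hbl : 0 < b + l := by positivity
  have hm : ∀ a b, Measurable (betaPDF a b) := fun a b => by unfold betaPDF; fun_prop
  rw [betaMeasure, lintegral_withDensity_eq_lintegral_mul _ (hm _ _) (by fun_prop)]
  have : ∀ v, (betaPDF a b * fun v => ENNReal.ofReal v ^ m * ENNReal.ofReal (1 - v) ^ l) v =
      ENNReal.ofReal (beta (a + m) (b + l) / beta a b) * betaPDF (a + m) (b + l) v := by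
    intro v
    rw [Pi.mul_apply, betaPDF_eq, betaPDF_eq]
    split_ifs with h
    · have h1 : 0 < 1 - v := by linarith [h.2]
      have h2 := beta_pos ha hb
      have h3 := beta_pos ham hbl
      rw [← ENNReal.ofReal_pow h.1.le, ← ENNReal.ofReal_pow h1.le,
        ← ENNReal.ofReal_mul (by have := h.1; positivity),
        ← ENNReal.ofReal_mul (by have := h.1; positivity),
        ← ENNReal.ofReal_mul (by positivity)]
      congr 1
      rw [show a + m - 1 = (a - 1) + m by ring, show b + l - 1 = (b - 1) + l by ring,
        Real.rpow_add_natCast h.1.ne', Real.rpow_add_natCast h1.ne']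
      field_simp
    · simp
  rw [lintegral_congr this, lintegral_const_mul _ (hm _ _), lintegral_betaPDF_eq_one ham hbl,
    mul_one]

/-- The probability that a sample indexed by `ι` from stick-breaking weights has `k` distinct
values. -/
noncomputable def meanBlockSum (ι : Type) [Fintype ι] (k : ℕ) (α θ : ℝ) : ℝ≥0∞ :=
  ∫⁻ v, blockSum ι k (stickBreaking v) ∂stickMeasure α θ

lemma stickMoment_nonneg (hα1 : α < 1) (hθ : -α < θ) (m l : ℕ) :
    0 ≤ stickMoment α θ m l :=
  have h1 : 0 < 1 - α := by linarith
  have h2 : 0 < θ + α := by linarith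
  div_nonneg (beta_pos (by positivity) (by positivity)).le (beta_pos h1 h2).le

/-- For `V` beta distributed with parameters `1 - α` and `θ + α`, this bounds the mean of `(1 - V) ^
(n + 1)` by that of `1 - V`. The bound does not depend on `n`. -/
lemma stickMoment_zero_le (hα1 : α < 1) (hθ : -α < θ) (n : ℕ) :
    stickMoment α θ 0 (n + 1) ≤ 1 - (1 - α) / (θ + 1) := by
  have h1 : 0 < 1 - α := by linarith
  have h2 : 0 < θ + α := by linarith
  have h3 : 0 < θ + 1 := by linarith
  have key : ∀ n : ℕ, stickMoment α θ 0 (n + 1) =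
      stickMoment α θ 0 n * ((θ + α + n) / (θ + 1 + n)) := by
    intro n
    have h4 : 0 < θ + α + n := by positivity
    have h5 : 0 < θ + 1 + n := by positivity
    rw [stickMoment, stickMoment, beta, beta, beta]
    push_cast
    rw [show 1 - α + 0 + (θ + α + (n + 1)) = (θ + 1 + n) + 1 by ring,
      show 1 - α + 0 + (θ + α + n) = θ + 1 + n by ring,
      show θ + α + ((n : ℝ) + 1) = (θ + α + n) + 1 by ring, Real.Gamma_add_one h4.ne',
      Real.Gamma_add_one h5.ne']
    have := (Real.Gamma_pos_of_pos h5).ne'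
    field_simp
  induction n with
  | zero =>
    rw [key, stickMoment]
    simp only [Nat.cast_zero, add_zero]
    rw [div_self (beta_pos h1 h2).ne', one_mul]
    apply le_of_eq
    field_simp
    ring
  | succ n ih =>
    rw [key]
    refine le_trans (mul_le_of_le_one_right (stickMoment_nonneg hα1 hθ _ _) ?_) ih
    rw [div_le_one (by positivity)]
    linarith

section

variable {ι κ : Type} [Fintype ι] [Fintype κ]

lemma meanBlockSum_le_one (hα0 : 0 < α) (hα1 : α < 1) (hθ : -α < θ) (k : ℕ) :
    meanBlockSum ι k α θ ≤ 1 := by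
  have := isProbabilityMeasure_stick hα0 hα1 hθ
  have : IsProbabilityMeasure (stickMeasure α θ) := by unfold stickMeasure; infer_instance
  calc meanBlockSum ι k α θ ≤ ∫⁻ _, 1 ∂stickMeasure α θ := by
        refine lintegral_mono_ae ?_
        filter_upwards [ae_stickMeasure hα0 hα1 hθ] with v hv
        refine blockSum_le_one k fun N => ?_
        rw [← ENNReal.ofReal_sum_of_nonneg fun i _ => (stickBreaking_pos hv i).le]
        exact ENNReal.ofReal_le_one.2 (sum_stickBreaking_le_one hv N)
    _ = 1 := by simp

/-- Independence of the first fraction from the others separates the integral; the shifted fractions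
follow `stickMeasure α (θ + α)`. -/
lemma meanBlockSum_succ [DecidableEq ι] (hα0 : 0 < α) (hα1 : α < 1) (hθ : -α < θ) (k : ℕ) :
    meanBlockSum ι (k + 1) α θ = ∑ A : Finset ι,
      ENNReal.ofReal (stickMoment α θ A.card (Fintype.card {i // i ∉ A})) *
        meanBlockSum {i // i ∉ A} (if A = ∅ then k + 1 else k) α (θ + α) := by
  have hP := isProbabilityMeasure_stick hα0 hα1 hθ
  have hP' := isProbabilityMeasure_stick hα0 hα1 (by linarith : -α < θ + α)
  have h0 : stickMeasure α θ =
      ((betaMeasure (1 - α) (θ + α)).prod (stickMeasure α (θ + α))).map consSeq := by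
    rw [stickMeasure, ← map_consSeq_prod_infinitePi, stickMeasure]
    congr 4
    · simp
    · funext i; congr 1; push_cast; ring
  have : IsProbabilityMeasure (stickMeasure α (θ + α)) := by unfold stickMeasure; infer_instance
  have hm : ∀ (ι : Type) [Fintype ι] k, Measurable fun v => blockSum ι k (stickBreaking v) :=
    fun ι _ k => (measurable_blockSum k).comp measurable_stickBreaking
  have hmc : ∀ A : Finset ι, Measurable fun v : ℝ => ENNReal.ofReal v ^ A.card *
      ENNReal.ofReal (1 - v) ^ Fintype.card {i // i ∉ A} := fun A => by fun_prop
  rw [meanBlockSum, h0, lintegral_map (hm _ _) measurable_consSeq,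
    lintegral_prod (fun q => blockSum ι (k + 1) (stickBreaking (consSeq q)))
      ((hm _ _).comp measurable_consSeq).aemeasurable]
  calc _ = ∫⁻ v, ∑ A : Finset ι, ENNReal.ofReal v ^ A.card *
      ENNReal.ofReal (1 - v) ^ Fintype.card {i // i ∉ A} *
        meanBlockSum {i // i ∉ A} (if A = ∅ then k + 1 else k) α (θ + α)
          ∂betaMeasure (1 - α) (θ + α) := by
        refine lintegral_congr_ae ?_
        filter_upwards [ae_betaMeasure _ _] with v hv
        have h1 : ∀ v', blockSum ι (k + 1) (stickBreaking (consSeq (v, v'))) =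
            ∑ A : Finset ι, ENNReal.ofReal v ^ A.card *
            ENNReal.ofReal (1 - v) ^ Fintype.card {i // i ∉ A} *
            blockSum {i // i ∉ A} (if A = ∅ then k + 1 else k) (stickBreaking v') := fun v' =>
          blockSum_succ (by linarith [hv.2]) (by simp [stickBreaking, consSeq])
            (fun i => stickBreaking_consSeq_succ (v, v') i) k
        rw [lintegral_congr h1, lintegral_finsetSum _ fun A _ => (hm _ _).const_mul _]
        exact sum_congr rfl fun A _ => lintegral_const_mul _ (hm _ _)
    _ = _ := by
        rw [lintegral_finsetSum _ fun A _ => (hmc A).mul_const _]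
        refine sum_congr rfl fun A _ => ?_
        rw [lintegral_mul_const _ (hmc A), lintegral_betaMeasure (by linarith) (by linarith)]
        rfl

lemma meanBlockSum_congr (e : ι ≃ κ) (k : ℕ) : meanBlockSum ι k α θ = meanBlockSum κ k α θ :=
  lintegral_congr fun _ => blockSum_congr e k _

lemma tendsto_prod_one_sub_div (hα0 : 0 < α) (hα1 : α < 1) (hθ : -α < θ) :
    Filter.Tendsto (fun J => ∏ j ∈ range J, (1 - (1 - α) / (θ + j * α + 1))) Filter.atTop
      (nhds 0) := by
  set c : ℝ := (1 - α) / (θ + α + 1) with hc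
  have hc0 : 0 < c := div_pos (by linarith) (by linarith)
  -- Since `θ + j * α + 1 ≤ (θ + α + 1) * (j + 1)`, the subtracted terms dominate a multiple of the
  -- harmonic series.
  have hle : ∀ j : ℕ, c * (1 / ((j : ℝ) + 1)) ≤ (1 - α) / (θ + j * α + 1) := fun j => by
    have hj : (0 : ℝ) ≤ j := j.cast_nonneg
    have h1 : 0 < θ + j * α + 1 := by nlinarith
    rw [hc, div_mul_div_comm, mul_one]
    gcongr
    nlinarith [mul_nonneg hj (by linarith : 0 ≤ θ + 1)]
  refine squeeze_zero (fun J => prod_nonneg fun j _ => ?_)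
    (g := fun J => Real.exp (-(c * ∑ j ∈ range J, 1 / ((j : ℝ) + 1)))) (fun J => ?_) ?_
  · have hj : (0 : ℝ) ≤ j := j.cast_nonneg
    have h1 : 0 < θ + j * α + 1 := by nlinarith
    rw [sub_nonneg, div_le_one h1]
    nlinarith
  · rw [mul_sum, ← sum_neg_distrib, Real.exp_sum]
    refine prod_le_prod (fun j _ => ?_) fun j _ => ?_
    · have hj : (0 : ℝ) ≤ j := j.cast_nonneg
      have h1 : 0 < θ + j * α + 1 := by nlinarith
      rw [sub_nonneg, div_le_one h1]
      nlinarith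
    · have := Real.add_one_le_exp (-(c * (1 / ((j : ℝ) + 1))))
      linarith [hle j]
  · exact Real.tendsto_exp_neg_atTop_nhds_zero.comp
      (Real.tendsto_sum_range_one_div_nat_succ_atTop.const_mul_atTop hc0)

/-- The law of the number of distinct values in a sample from stick-breaking weights. -/
lemma meanBlockSum_eq (hα0 : 0 < α) (hα1 : α < 1) (hθ : -α < θ) (hn : Fintype.card ι ≠ 0) (k : ℕ) :
    meanBlockSum ι k α θ = ENNReal.ofReal (blockProb (Fintype.card ι) k α θ) := by
  classical
  -- The induction varies `θ`, since the recursion moves it to `θ + α`. The empty sample has to be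
  -- included, as one block may exhaust the sample; the value `θ + α` met there is positive.
  suffices H : ∀ N : ℕ, ∀ (ι : Type) [Fintype ι], Fintype.card ι = N → ∀ (k : ℕ) (θ : ℝ),
      -α < θ → (N = 0 → 0 < θ) → (meanBlockSum ι k α θ).toReal = blockProb N k α θ by
    rw [← H _ ι rfl k θ hθ fun h => absurd h hn, ENNReal.ofReal_toReal]
    exact ne_top_of_le_ne_top ENNReal.one_ne_top (meanBlockSum_le_one hα0 hα1 hθ k)
  clear hn hθ k
  intro N
  induction N using Nat.strong_induction_on with
  | _ N ih =>
    intro ι _ hι k θ hθ hN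
    have hP := isProbabilityMeasure_stick hα0 hα1 hθ
    have : IsProbabilityMeasure (stickMeasure α θ) := by unfold stickMeasure; infer_instance
    rcases Nat.eq_zero_or_pos N with h0 | hNpos
    · subst h0
      have : IsEmpty ι := Fintype.card_eq_zero_iff.1 hι
      rw [blockProb_zero_left hα0 (hN rfl), meanBlockSum]
      simp only [blockSum_of_isEmpty]
      split_ifs <;> simp
    · have : Nonempty ι := Fintype.card_pos_iff.1 (hι ▸ hNpos)
      cases k with
      | zero => simp [meanBlockSum, blockSum_zero, blockProb, genFactSum_zero_right, hNpos.ne']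
      | succ k =>
        set Δ : ℝ → ℝ := fun θ => (meanBlockSum ι (k + 1) α θ).toReal - blockProb N (k + 1) α θ
          with hΔ
        have hbound : ∀ θ, -α < θ → |Δ θ| ≤ 1 := fun θ hθ => by
          have h1 := blockProb_nonneg hα0 hα1 hθ hNpos.ne' (k + 1)
          have h2 := blockProb_le_one hα0 hα1 hθ hNpos.ne' (k + 1)
          have h3 : (meanBlockSum ι (k + 1) α θ).toReal ≤ 1 :=
            ENNReal.toReal_mono ENNReal.one_ne_top (meanBlockSum_le_one hα0 hα1 hθ (k + 1))
          have h4 := ENNReal.toReal_nonneg (a := meanBlockSum ι (k + 1) α θ)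
          rw [abs_le]
          constructor <;> simp only [hΔ] <;> linarith
        -- All terms with `A` nonempty concern smaller samples and agree by induction; only `A = ∅`
        -- survives in the difference.
        have hrec : ∀ θ, -α < θ → Δ θ = stickMoment α θ 0 N * Δ (θ + α) := fun θ hθ => by
          have hne : ∀ (κ : Type) [Fintype κ] (k : ℕ), meanBlockSum κ k α (θ + α) ≠ ⊤ :=
            fun κ _ k => ne_top_of_le_ne_top ENNReal.one_ne_top
              (meanBlockSum_le_one hα0 hα1 (by linarith) k)
          have hcard : ∀ A : Finset ι, Fintype.card {i // i ∉ A} = N - A.card := fun A => by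
            rw [Fintype.card_subtype_compl, hι, Fintype.card_coe]
          have h1 : (meanBlockSum ι (k + 1) α θ).toReal = ∑ A : Finset ι,
              stickMoment α θ A.card (N - A.card) * (meanBlockSum {i // i ∉ A}
                (if A = ∅ then k + 1 else k) α (θ + α)).toReal := by
            rw [meanBlockSum_succ hα0 hα1 hθ, ENNReal.toReal_sum
              fun A _ => ENNReal.mul_ne_top ENNReal.ofReal_ne_top (hne _ _)]
            refine sum_congr rfl fun A _ => ?_
            rw [ENNReal.toReal_mul, ENNReal.toReal_ofReal (stickMoment_nonneg hα1 hθ _ _),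
              hcard]
          set h : ℕ → ℝ := fun m =>
            stickMoment α θ m (N - m) * blockProb (N - m) k α (θ + α) with hh
          have h2 : ∀ A ∈ (univ : Finset (Finset ι)).erase ∅,
              stickMoment α θ A.card (N - A.card) * (meanBlockSum {i // i ∉ A}
                (if A = ∅ then k + 1 else k) α (θ + α)).toReal = h A.card := fun A hA => by
            have hA : A ≠ ∅ := ne_of_mem_erase hA
            have hA' := card_pos.2 (nonempty_iff_ne_empty.2 hA)
            rw [if_neg hA, hh, ih _ (by omega) _ (hcard A) _ _ (by linarith) fun _ => by linarith]
          have h3 : ∑ A : Finset ι, h A.card = ∑ ij ∈ antidiagonal N, (N.choose ij.1 : ℝ) *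
              (stickMoment α θ ij.1 ij.2 * blockProb ij.2 k α (θ + α)) := by
            rw [← powerset_univ, sum_powerset_apply_card, card_univ, hι,
              Nat.sum_antidiagonal_eq_sum_range_succ_mk]
            exact sum_congr rfl fun i _ => by simp [hh]
          have h4 : meanBlockSum {i : ι // i ∉ (∅ : Finset ι)} (k + 1) α (θ + α) =
              meanBlockSum ι (k + 1) α (θ + α) :=
            meanBlockSum_congr (Equiv.subtypeUnivEquiv fun i => by simp) _
          have h5 := add_sum_erase univ (fun A : Finset ι => h A.card) (mem_univ ∅)
          rw [← add_sum_erase univ _ (mem_univ (∅ : Finset ι)), sum_congr rfl h2, if_pos rfl, h4]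
            at h1
          have h6 := blockProb_succ hα0 hα1 hθ hNpos.ne' k
          simp only [hΔ]
          rw [h1, h6, ← h3, ← h5]
          simp only [hh, card_empty, Nat.sub_zero]
          ring
        have hiter : ∀ J : ℕ, |Δ θ| ≤ (∏ j ∈ range J, (1 - (1 - α) / (θ + j * α + 1))) *
            |Δ (θ + J * α)| := by
          intro J
          induction J with
          | zero => simp
          | succ J ihJ =>
            have hJ : (0 : ℝ) ≤ J := J.cast_nonneg
            have h1 : -α < θ + J * α := by nlinarith
            refine ihJ.trans ?_
            rw [prod_range_succ, mul_assoc]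
            refine mul_le_mul_of_nonneg_left ?_ (prod_nonneg fun j _ => ?_)
            · rw [hrec _ h1, abs_mul, abs_of_nonneg (stickMoment_nonneg hα1 h1 _ _),
                show θ + J * α + α = θ + ((J + 1 : ℕ) : ℝ) * α by push_cast; ring]
              refine mul_le_mul_of_nonneg_right ?_ (abs_nonneg _)
              obtain ⟨n, rfl⟩ := Nat.exists_eq_succ_of_ne_zero hNpos.ne'
              exact stickMoment_zero_le hα1 h1 n
            · have hj : (0 : ℝ) ≤ j := j.cast_nonneg
              have h1 : 0 < θ + j * α + 1 := by nlinarith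
              rw [sub_nonneg, div_le_one h1]
              nlinarith
        have hlim : |Δ θ| ≤ 0 := by
          refine ge_of_tendsto' (tendsto_prod_one_sub_div hα0 hα1 hθ) fun J => ?_
          refine (hiter J).trans (mul_le_of_le_one_right (prod_nonneg fun j _ => ?_) ?_)
          · have hj : (0 : ℝ) ≤ j := j.cast_nonneg
            have h1 : 0 < θ + j * α + 1 := by nlinarith
            rw [sub_nonneg, div_le_one h1]
            nlinarith
          · have hJ : (0 : ℝ) ≤ J := J.cast_nonneg
            exact hbound _ (by nlinarith)
        exact sub_eq_zero.1 (abs_nonpos_iff.1 hlim)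

end

end StickBreaking

end PitmanYor

namespace PitmanYor

/-! ### Ranking as a rearrangement -/

section Ranked

open Finset
open scoped ENNReal

lemma measurable_ranked : Measurable ranked := by
  refine measurable_pi_lambda _ fun k => ?_
  unfold ranked
  refine Measurable.iSup fun s => ?_
  have h : ∀ hs : s.1.Nonempty, Measurable fun p : ℕ → ℝ => s.1.inf' hs p := fun hs => by
    have := Finset.inf'_induction (p := fun f : (ℕ → ℝ) → ℝ => Measurable f) hs
      (fun i p => p i) (fun _ h1 _ h2 => h1.inf h2) (fun i _ => measurable_pi_apply i)
    convert this using 2 with p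
    simp
  exact h _

variable {p : ℕ → ℝ}

lemma inf'_le_ranked {C : ℝ} (hC : ∀ i, p i ≤ C) (s : Finset ℕ) {k : ℕ} (hs : s.card = k + 1)
    (h : s.Nonempty) : s.inf' h p ≤ ranked p k := by
  refine le_ciSup (f := fun s : {s : Finset ℕ // s.card = k + 1} =>
    s.1.inf' (Finset.card_pos.mp (by rw [s.2]; exact Nat.succ_pos k)) p) ⟨C, ?_⟩ ⟨s, hs⟩
  rintro _ ⟨s, rfl⟩
  obtain ⟨i, hi⟩ := Finset.card_pos.mp (by rw [s.2]; exact Nat.succ_pos k)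
  exact (inf'_le p hi).trans (hC i)

lemma ranked_pos {C : ℝ} (hC : ∀ i, p i ≤ C) (hp : ∀ i, 0 < p i) (k : ℕ) : 0 < ranked p k :=
  lt_of_lt_of_le ((lt_inf'_iff (nonempty_range_add_one (n := k))).2 fun i _ => hp i)
    (inf'_le_ranked hC (range (k + 1)) (card_range _) _)

/-- Level sets determine the ranked sequence: the first ranks, as many as there are weights at least
`t`, are those with value at least `t`. -/
lemma le_ranked_iff {C : ℝ} (hC : ∀ i, p i ≤ C) (hfin : ∀ t : ℝ, 0 < t → {i | t ≤ p i}.Finite)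
    {t : ℝ} (ht : 0 < t) (k : ℕ) : t ≤ ranked p k ↔ k < {i | t ≤ p i}.ncard := by
  constructor
  · intro h
    by_contra! hk
    -- A gap below `t` is required, because a supremum of minima below `t` could otherwise equal
    -- `t`. Only finitely many weights lie in `[t / 2, t)`, so their maximum, or `t / 2`, serves.
    obtain ⟨t', ht', hlt⟩ : ∃ t' < t, ∀ i, p i < t → p i ≤ t' := by
      have hf : {i | t / 2 ≤ p i ∧ p i < t}.Finite :=
        (hfin _ (half_pos ht)).subset fun i hi => hi.1
      set F := insert (t / 2) (hf.toFinset.image p)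
      have hF : F.Nonempty := insert_nonempty _ _
      refine ⟨F.max' hF, ?_, fun i hi => ?_⟩
      · rw [max'_lt_iff]
        intro y hy
        rcases mem_insert.1 hy with rfl | hy
        · exact half_lt_self ht
        · obtain ⟨i, hi, rfl⟩ := mem_image.1 hy
          exact ((Set.Finite.mem_toFinset _).1 hi).2
      · rcases le_total (t / 2) (p i) with h2 | h2
        · exact le_max' _ _ (mem_insert_of_mem (mem_image_of_mem _
            (by simpa using ⟨h2, hi⟩)))
        · exact h2.trans (le_max' _ _ (mem_insert_self _ _))
    refine absurd (h.trans (?_ : ranked p k ≤ t')) (not_le.2 ht')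
    have : Nonempty {s : Finset ℕ // s.card = k + 1} := ⟨⟨range (k + 1), card_range _⟩⟩
    refine ciSup_le fun s => ?_
    obtain ⟨i, his, hi⟩ : ∃ i ∈ s.1, p i < t := by
      by_contra! hcon
      have := Set.ncard_le_ncard (s := (s.1 : Set ℕ)) (t := {i | t ≤ p i})
        (fun i hi => by simpa using hcon i hi) (hfin t ht)
      rw [Set.ncard_coe_finset, s.2] at this
      omega
    exact (inf'_le p his).trans (hlt i hi)
  · intro h
    rw [Set.ncard_eq_toFinset_card _ (hfin t ht)] at h
    obtain ⟨s, hs, hcard⟩ := exists_subset_card_eq (Nat.succ_le_of_lt h)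
    have hne : s.Nonempty := card_pos.1 (by omega)
    refine le_trans ?_ (inf'_le_ranked hC s hcard hne)
    exact (le_inf'_iff hne _).2 fun i hi => by simpa using hs hi

lemma lt_ranked_iff {C : ℝ} (hC : ∀ i, p i ≤ C) (hfin : ∀ t : ℝ, 0 < t → {i | t ≤ p i}.Finite)
    {t : ℝ} (ht : 0 < t) (k : ℕ) : t < ranked p k ↔ k < {i | t < p i}.ncard := by
  have hf : {i | t < p i}.Finite :=
    (hfin t ht).subset (Set.ofPred_subset_ofPred.2 fun _ hi => le_of_lt hi)
  constructor
  · intro h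
    exact ((le_ranked_iff hC hfin (ht.trans h) k).1 le_rfl).trans_le
      (Set.ncard_le_ncard (Set.ofPred_subset_ofPred.2 fun _ hi => lt_of_lt_of_le h hi) hf)
  · intro h
    rw [Set.ncard_eq_toFinset_card _ hf] at h
    obtain ⟨s, hs, hcard⟩ := exists_subset_card_eq (Nat.succ_le_of_lt h)
    have hne : s.Nonempty := card_pos.1 (by omega)
    refine lt_of_lt_of_le ?_ (inf'_le_ranked hC s hcard hne)
    exact (lt_inf'_iff hne).2 fun i hi => by simpa using hs hi

lemma ncard_eq_fiber {q : ℕ → ℝ} {c : ℝ} (h : {i | c ≤ q i}.Finite) :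
    {i | q i = c}.Finite ∧ {i | q i = c}.ncard = {i | c ≤ q i}.ncard - {i | c < q i}.ncard := by
  have h1 : {i | q i = c} = {i | c ≤ q i} \ {i | c < q i} := by
    ext i
    simp only [Set.mem_ofPred_eq, Set.mem_sdiff, not_lt]
    exact ⟨fun h => ⟨h.ge, h.le⟩, fun h => le_antisymm h.2 h.1⟩
  have h2 : {i | c < q i} ⊆ {i | c ≤ q i} :=
    Set.ofPred_subset_ofPred.2 fun _ hi => le_of_lt hi
  exact ⟨h.subset (Set.ofPred_subset_ofPred.2 fun _ hi => hi.ge), by rw [h1, Set.ncard_sdiff h2 (h.subset h2)]⟩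

/-- Ranking a positive sequence that tends to zero is a rearrangement. -/
lemma exists_ranked_eq_comp {C : ℝ} (hC : ∀ i, p i ≤ C) (hp : ∀ i, 0 < p i)
    (hfin : ∀ t : ℝ, 0 < t → {i | t ≤ p i}.Finite) : ∃ σ : ℕ ≃ ℕ, ranked p = p ∘ σ := by
  -- Equal multiplicity of every value suffices: bijections between fibres glue to a permutation.
  -- For `c > 0` the fibres are finite, with size the difference of the counts for `≥ c` and `> c`;
  -- for `c ≤ 0` both are empty.
  have H : ∀ c : ℝ, Nonempty ({k // ranked p k = c} ≃ {i // p i = c}) := by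
    intro c
    rcases le_or_gt c 0 with hc | hc
    · have : IsEmpty {k // ranked p k = c} :=
        ⟨fun k => by linarith [ranked_pos hC hp k.1, k.2]⟩
      have : IsEmpty {i // p i = c} := ⟨fun i => by linarith [hp i.1, i.2]⟩
      exact ⟨Equiv.equivOfIsEmpty _ _⟩
    · have e1 : {k | c ≤ ranked p k} = Set.Iio {i | c ≤ p i}.ncard :=
        Set.ext fun k => le_ranked_iff hC hfin hc k
      have e2 : {k | c < ranked p k} = Set.Iio {i | c < p i}.ncard :=
        Set.ext fun k => lt_ranked_iff hC hfin hc k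
      obtain ⟨f1, n1⟩ := ncard_eq_fiber (q := ranked p) (c := c) (e1 ▸ Set.finite_Iio _)
      obtain ⟨f2, n2⟩ := ncard_eq_fiber (hfin c hc)
      have e3 : ∀ N : ℕ, (Set.Iio N).ncard = N := fun N => by
        rw [← Finset.coe_Iio, Set.ncard_coe_finset, Nat.card_Iio]
      rw [e1, e2, e3, e3, ← n2] at n1
      have : Finite {k // ranked p k = c} := f1.to_subtype
      have : Finite {i // p i = c} := f2.to_subtype
      exact (Finite.card_eq.1 n1)
  exact ⟨Equiv.ofFiberEquiv fun c => (H c).some,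
    funext fun k => (Equiv.ofFiberEquiv_map (fun c => (H c).some) k).symm⟩

lemma finite_setOf_le (hp : ∀ i, 0 < p i) (hsum : ∀ N, ∑ i ∈ range N, p i ≤ 1) {t : ℝ}
    (ht : 0 < t) : {i | t ≤ p i}.Finite := by
  have h1 : Summable p := summable_of_sum_range_le (fun i => (hp i).le) hsum
  have h2 := h1.tendsto_cofinite_zero.eventually (gt_mem_nhds ht)
  rw [Filter.eventually_cofinite] at h2
  simpa using h2

lemma blockSum_ranked {ι : Type} [Fintype ι] (k : ℕ) (hp : ∀ i, 0 < p i)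
    (hsum : ∀ N, ∑ i ∈ range N, p i ≤ 1) : blockSum ι k (ranked p) = blockSum ι k p := by
  have hC : ∀ i, p i ≤ 1 := fun i =>
    (single_le_sum (fun j _ => (hp j).le) (self_mem_range_succ i)).trans (hsum (i + 1))
  obtain ⟨σ, hσ⟩ := exists_ranked_eq_comp hC hp fun t ht => finite_setOf_le hp hsum ht
  rw [hσ, blockSum_comp_equiv]

variable {α θ : ℝ}

/-- The law of the number of distinct values in a random sample from `PD(α, θ)`. -/
lemma measure_numBlocks_eq {n : ℕ} (hn : n ≠ 0) (hα0 : 0 < α) (hα1 : α < 1) (hθ : -α < θ)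
    {Ω : Type*} [MeasurableSpace Ω] {μ : Measure Ω}
    {P : Ω → ℕ → ℝ} (hP : HasLaw P (poissonDirichlet α θ) μ)
    {X : Fin n → Ω → ℕ} (hX : IsRandomSample X P μ) (k : ℕ) :
    μ {ω | numBlocks X ω = k} = ENNReal.ofReal (blockProb n k α θ) := by
  have hXm : Measurable fun ω i => X i ω := measurable_pi_lambda _ hX.measurable
  have h1 : μ {ω | numBlocks X ω = k} =
      ∑' x : Fin n → ℕ, if (univ.image x).card = k then μ {ω | ∀ i, X i ω = x i} else 0 := by
    have h2 : {ω | numBlocks X ω = k} =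
        (fun ω i => X i ω) ⁻¹' {x : Fin n → ℕ | (univ.image x).card = k} := rfl
    rw [h2, ← Measure.map_apply hXm (Set.to_countable _).measurableSet,
      ← Measure.tsum_indicator_apply_singleton _ _ (Set.to_countable _).measurableSet]
    refine tsum_congr fun x => ?_
    rw [Set.indicator_apply, Measure.map_apply hXm (measurableSet_singleton x)]
    have h3 : (fun ω i => X i ω) ⁻¹' {x} = {ω | ∀ i, X i ω = x i} := by
      ext ω; simp [funext_iff]
    rw [h3]
    rfl
  have h2 : ∀ x : Fin n → ℕ, μ {ω | ∀ i, X i ω = x i} =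
      ∫⁻ ω, ∏ i, ENNReal.ofReal (P ω (x i)) ∂μ := fun x => by
    simpa using hX.joint x Set.univ .univ
  have hPm := hP.aemeasurable
  have hPi : ∀ j, AEMeasurable (fun ω => P ω j) μ := fun j =>
    (measurable_pi_apply j).comp_aemeasurable hPm
  have h3 : μ {ω | numBlocks X ω = k} = ∫⁻ ω, blockSum (Fin n) k (P ω) ∂μ := by
    unfold blockSum
    rw [h1, lintegral_tsum]
    · refine tsum_congr fun x => ?_
      split_ifs
      · exact h2 x
      · simp
    · intro x
      split_ifs
      · exact Finset.aemeasurable_fun_prod _ fun i _ => (hPi _).ennreal_ofReal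
      · fun_prop
  have hr : Measurable fun v => ranked (stickBreaking v) :=
    measurable_ranked.comp measurable_stickBreaking
  rw [h3, ← lintegral_map' (f := blockSum (Fin n) k) (measurable_blockSum k).aemeasurable hPm,
    hP.map_eq, poissonDirichlet, lintegral_map (measurable_blockSum k) hr]
  have h4 := meanBlockSum_eq (ι := Fin n) hα0 hα1 hθ (by simpa using hn) k
  rw [Fintype.card_fin] at h4
  rw [← h4]
  refine lintegral_congr_ae ?_
  filter_upwards [ae_stickMeasure hα0 hα1 hθ] with v hv
  exact blockSum_ranked k (stickBreaking_pos hv) (sum_stickBreaking_le_one hv)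

end Ranked

end PitmanYor

namespace PitmanYor

/-! ### Stable laws, derivatives of the Laplace transform, and the mixing law -/

section Stable

open Finset
open scoped ENNReal

variable {α θ : ℝ} {f : ℝ → ℝ}

/-- The positive stable distribution with density `f`. -/
noncomputable def stableMeasure (f : ℝ → ℝ) : Measure ℝ :=
  (volume.restrict (Set.Ioi 0)).withDensity fun x => ENNReal.ofReal (f x)

lemma ae_stableMeasure (f : ℝ → ℝ) : ∀ᵐ x ∂stableMeasure f, 0 < x :=
  (withDensity_absolutelyContinuous _ _).ae_le (ae_restrict_mem measurableSet_Ioi)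

lemma isFiniteMeasure_stableMeasure (hf : IsPositiveStableDensity α f) :
    IsFiniteMeasure (stableMeasure f) := by
  refine isFiniteMeasure_withDensity_ofReal ?_
  have h := hf.laplace 0 le_rfl
  simp only [zero_mul, neg_zero, Real.exp_zero, one_mul] at h
  have : Integrable f (volume.restrict (Set.Ioi 0)) := by
    by_contra hcon
    rw [integral_undef hcon] at h
    exact (Real.exp_pos _).ne h
  -- The Laplace identity at `0` forces integrability, since the integral of a non-integrable
  -- function would be `0`.
  exact this.2

lemma mgf_stableMeasure (hf : IsPositiveStableDensity α f) {l : ℝ} (hl : 0 ≤ l) :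
    ∫ x, Real.exp (-l * x) ∂stableMeasure f = Real.exp (-(l ^ α)) := by
  rw [stableMeasure, integral_withDensity_eq_integral_toReal_smul
    hf.measurable.ennreal_ofReal (Filter.Eventually.of_forall fun _ => ENNReal.ofReal_lt_top),
    ← hf.laplace l hl]
  refine integral_congr_ae (Filter.Eventually.of_forall fun x => ?_)
  simp only [smul_eq_mul]
  rw [ENNReal.toReal_ofReal (hf.nonneg x), mul_comm, neg_mul]

/-- On the positive half line every negative exponential tilt is bounded. Interior points are where
the integral may be differentiated under the integral sign. -/
lemma mem_interior_integrableExpSet_stableMeasure (hf : IsPositiveStableDensity α f) {l : ℝ}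
    (hl : 0 < l) : -l ∈ interior (integrableExpSet id (stableMeasure f)) := by
  have := isFiniteMeasure_stableMeasure hf
  have hsub : Set.Iio (0 : ℝ) ⊆ integrableExpSet id (stableMeasure f) := fun t ht => by
    refine Integrable.of_bound (C := 1) (by fun_prop) ?_
    filter_upwards [ae_stableMeasure f] with x hx
    rw [Real.norm_eq_abs, abs_of_pos (Real.exp_pos _), Real.exp_le_one_iff]
    exact mul_nonpos_of_nonpos_of_nonneg (le_of_lt ht) hx.le
  exact interior_maximal hsub isOpen_Iio (by simpa using hl)

/-- The derivatives of `w ↦ exp (-(w ^ α))`, up to sign. -/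
noncomputable def expRpowDeriv (α : ℝ) (n : ℕ) (w : ℝ) : ℝ :=
  Real.exp (-(w ^ α)) * ∑ j ∈ range (n + 1), genFactSum n j α * w ^ (j * α - n)

lemma hasDerivAt_expRpowDeriv (α : ℝ) (n : ℕ) {w : ℝ} (hw : 0 < w) :
    HasDerivAt (expRpowDeriv α n) (-expRpowDeriv α (n + 1) w) w := by
  have h1 : HasDerivAt (fun w : ℝ => Real.exp (-(w ^ α)))
      (Real.exp (-(w ^ α)) * -(α * w ^ (α - 1))) w :=
    (Real.hasDerivAt_rpow_const (Or.inl hw.ne')).neg.exp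
  have h2 : HasDerivAt (fun w : ℝ => ∑ j ∈ range (n + 1), genFactSum n j α * w ^ (j * α - n))
      (∑ j ∈ range (n + 1), genFactSum n j α * ((j * α - n) * w ^ (j * α - n - 1))) w :=
    HasDerivAt.fun_sum fun j _ => (Real.hasDerivAt_rpow_const (Or.inl hw.ne')).const_mul _
  convert! h1.mul h2 using 1
  -- These are the terms from differentiating the powers, up to sign. Both `g 0` and `g (n + 1)`
  -- vanish, so the sum may be shifted to match the triangular recursion.
  set g : ℕ → ℝ := fun j => (n - j * α) * genFactSum n j α * w ^ (j * α - n - 1) with hg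
  have h3 : ∑ j ∈ range (n + 1), g (j + 1) = ∑ j ∈ range (n + 1), g j := by
    have e1 : g 0 = 0 := by
      simp only [hg, genFactSum_zero_right]
      split_ifs with h <;> simp [h]
    have e2 : g (n + 1) = 0 := by
      simp [hg, genFactSum_eq_zero_of_lt]
    have := sum_range_succ' g (n + 1)
    rw [sum_range_succ g (n + 1), e1, e2] at this
    linarith
  have h4 : ∑ j ∈ range (n + 2), genFactSum (n + 1) j α * w ^ (j * α - (n + 1 : ℕ)) =
      ∑ j ∈ range (n + 1), g j +
        α * w ^ (α - 1) * ∑ j ∈ range (n + 1), genFactSum n j α * w ^ (j * α - n) := by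
    rw [sum_range_succ', genFactSum_zero_right, if_neg (by omega), zero_mul, add_zero, ← h3,
      mul_sum, ← sum_add_distrib]
    refine sum_congr rfl fun j _ => ?_
    have e3 : w ^ (((j + 1 : ℕ) : ℝ) * α - n - 1) = w ^ (α - 1) * w ^ (j * α - n) := by
      rw [← Real.rpow_add hw]; congr 1; push_cast; ring
    have e4 : ((j + 1 : ℕ) : ℝ) * α - (n + 1 : ℕ) = ((j + 1 : ℕ) : ℝ) * α - n - 1 := by
      push_cast; ring
    rw [genFactSum_succ_succ, e4, hg]
    simp only
    rw [e3]
    push_cast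
    ring
  have h5 : ∑ j ∈ range (n + 1), genFactSum n j α * ((j * α - n) * w ^ (j * α - n - 1)) =
      -∑ j ∈ range (n + 1), g j := by
    rw [← sum_neg_distrib]
    exact sum_congr rfl fun j _ => by simp only [hg]; ring
  rw [expRpowDeriv, h4, h5]
  ring

/-- The tilted moments of the positive stable distribution. -/
lemma integral_pow_mul_exp_stableMeasure (hf : IsPositiveStableDensity α f) (n : ℕ) {w : ℝ}
    (hw : 0 < w) :
    ∫ x, x ^ n * Real.exp (-w * x) ∂stableMeasure f = expRpowDeriv α n w := by
  induction n generalizing w with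
  | zero =>
    simp only [pow_zero, one_mul]
    rw [mgf_stableMeasure hf hw.le]
    simp [expRpowDeriv, genFactSum_zero_right]
  | succ n ih =>
    have h1 := (hasDerivAt_integral_pow_mul_exp_real
      (mem_interior_integrableExpSet_stableMeasure hf hw) n).comp w (hasDerivAt_neg w)
    have h2 : ((fun t => ∫ x, id x ^ n * Real.exp (t * id x) ∂stableMeasure f) ∘ Neg.neg)
        =ᶠ[nhds w] expRpowDeriv α n := by
      filter_upwards [lt_mem_nhds hw] with v hv
      exact ih hv
    have h3 := (h1.congr_of_eventuallyEq h2.symm).unique (hasDerivAt_expRpowDeriv α n hw)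
    simp only [id] at h3
    linarith

lemma lintegral_pow_mul_exp_stableMeasure (hf : IsPositiveStableDensity α f) (n : ℕ) {w : ℝ}
    (hw : 0 < w) :
    ∫⁻ x, ENNReal.ofReal (x ^ n * Real.exp (-w * x)) ∂stableMeasure f =
      ENNReal.ofReal (expRpowDeriv α n w) := by
  rw [← integral_pow_mul_exp_stableMeasure hf n hw, ofReal_integral_eq_lintegral_ofReal]
  · exact integrable_pow_mul_exp_of_mem_interior_integrableExpSet
      (mem_interior_integrableExpSet_stableMeasure hf hw) n
  · filter_upwards [ae_stableMeasure f] with x hx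
    exact mul_nonneg (pow_nonneg hx.le _) (Real.exp_pos _).le

lemma expRpowDeriv_eq {n : ℕ} (hn : n ≠ 0) (α : ℝ) {w : ℝ} (hw : 0 < w) :
    expRpowDeriv α n w = Real.exp (-(w ^ α)) * (w ^ n)⁻¹ *
      ∑ j ∈ Icc 1 n, genFactCoeff n j α * (w ^ α) ^ j := by
  rw [expRpowDeriv, mul_assoc, mul_sum (Icc 1 n), range_eq_Ico,
    sum_eq_sum_Ico_succ_bot (by omega), genFactSum_zero_right, if_neg hn, zero_mul, zero_add]
  congr 1
  refine sum_congr rfl fun j _ => ?_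
  rw [genFactSum_eq hn, Real.rpow_sub hw, Real.rpow_natCast, mul_comm (j : ℝ),
    Real.rpow_mul hw.le, Real.rpow_natCast]
  field_simp

/-- Needed to cancel the denominator of `rho`; the term `j = 1` is strictly positive. -/
lemma sum_genFactCoeff_mul_pow_pos {n : ℕ} (hn : n ≠ 0) (hα0 : 0 < α) (hα1 : α < 1) {z : ℝ}
    (hz : 0 < z) : 0 < ∑ j ∈ Icc 1 n, genFactCoeff n j α * z ^ j := by
  refine sum_pos' (fun j _ => ?_) ⟨1, by simp; omega, ?_⟩
  · rw [← genFactSum_eq hn]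
    exact mul_nonneg (genFactSum_nonneg _ _ hα0 hα1) (by positivity)
  · rw [← genFactSum_eq hn]
    obtain ⟨n, rfl⟩ := Nat.exists_eq_succ_of_ne_zero hn
    exact mul_pos (genFactSum_one_pos _ hα0 hα1) (by positivity)

/-- Change of variables `x = t ^ r` on the positive half line. -/
lemma lintegral_Ioi_comp_rpow {r : ℝ} (hr : r ≠ 0) (g : ℝ → ℝ≥0∞) :
    ∫⁻ s in Set.Ioi 0, g s = ∫⁻ t in Set.Ioi 0, ENNReal.ofReal |r * t ^ (r - 1)| * g (t ^ r) := by
  have himg : (fun t : ℝ => t ^ r) '' Set.Ioi 0 = Set.Ioi 0 := by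
    ext s
    constructor
    · rintro ⟨t, ht, rfl⟩
      exact Real.rpow_pos_of_pos ht _
    · intro hs
      refine ⟨s ^ r⁻¹, Real.rpow_pos_of_pos hs _, ?_⟩
      simp only
      rw [← Real.rpow_mul (le_of_lt hs), inv_mul_cancel₀ hr, Real.rpow_one]
  have hinj : Set.InjOn (fun t : ℝ => t ^ r) (Set.Ioi 0) := fun a ha b hb hab =>
    (Real.rpow_left_inj (le_of_lt ha) (le_of_lt hb) hr).1 hab
  have := lintegral_image_eq_lintegral_abs_deriv_mul measurableSet_Ioi
    (fun t ht => (Real.hasDerivAt_rpow_const (Or.inl (ne_of_gt ht))).hasDerivWithinAt) hinj g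
  rwa [himg] at this

/-- Change of variables `x = t * w` on the positive half line. -/
lemma lintegral_Ioi_comp_mul_left {t : ℝ} (ht : 0 < t) (g : ℝ → ℝ≥0∞) :
    ∫⁻ s in Set.Ioi 0, g s = ∫⁻ w in Set.Ioi 0, ENNReal.ofReal t * g (t * w) := by
  have himg : (fun w : ℝ => t * w) '' Set.Ioi 0 = Set.Ioi 0 := by
    rw [Set.image_mul_left_Ioi ht, mul_zero]
  have hinj : Set.InjOn (fun w : ℝ => t * w) (Set.Ioi 0) :=
    (mul_right_injective₀ ht.ne').injOn
  have := lintegral_image_eq_lintegral_abs_deriv_mul measurableSet_Ioi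
    (fun w _ => (by simpa using (hasDerivAt_id w).const_mul t :
      HasDerivAt (fun w : ℝ => t * w) t w).hasDerivWithinAt) hinj g
  rwa [himg, abs_of_pos ht] at this

lemma lintegral_eq_setLIntegral_Ioi {g : ℝ → ℝ≥0∞} (hg : ∀ s ≤ 0, g s = 0) :
    ∫⁻ s, g s = ∫⁻ s in Set.Ioi 0, g s := by
  rw [← lintegral_add_compl g measurableSet_Ioi, setLIntegral_eq_zero measurableSet_Ioi.compl
    fun s hs => hg s (by simpa using hs), add_zero]

/-- The law of `S_{α,θ}` is that of `T ^ (-α)`, with `T` having a polynomially tilted positive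
stable distribution. -/
lemma lintegral_scaledMittagLeffler (hα0 : 0 < α) (hα1 : α < 1) (hθ : -α < θ)
    (hf : IsPositiveStableDensity α f) {H : ℝ → ℝ≥0∞} (hH : Measurable H) :
    ∫⁻ s, H s ∂volume.withDensity (fun s => ENNReal.ofReal (scaledMittagLefflerPDF α θ f s)) =
      ∫⁻ t, ENNReal.ofReal (Real.Gamma (θ + 1) / Real.Gamma (θ / α + 1) * t ^ (-θ)) * H (t ^ (-α))
        ∂stableMeasure f := by
  have h2 : 0 < θ / α + 1 := by
    rw [show θ / α + 1 = (θ + α) / α by field_simp]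
    exact div_pos (by linarith) hα0
  have g2 := Real.Gamma_pos_of_pos h2
  have g3 := Real.Gamma_pos_of_pos (by linarith : 0 < θ + 1)
  have hfm := hf.measurable
  have hm : Measurable fun s => ENNReal.ofReal (scaledMittagLefflerPDF α θ f s) := by
    refine Measurable.ennreal_ofReal ?_
    unfold scaledMittagLefflerPDF
    exact Measurable.ite measurableSet_Ioi (by fun_prop) (by fun_prop)
  have hm' : Measurable fun t : ℝ => ENNReal.ofReal
      (Real.Gamma (θ + 1) / Real.Gamma (θ / α + 1) * t ^ (-θ)) * H (t ^ (-α)) := by fun_prop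
  rw [lintegral_withDensity_eq_lintegral_mul _ hm hH, stableMeasure,
    lintegral_withDensity_eq_lintegral_mul _ hfm.ennreal_ofReal hm',
    lintegral_eq_setLIntegral_Ioi fun s hs => by
      simp [scaledMittagLefflerPDF, not_lt.2 hs],
    lintegral_Ioi_comp_rpow (neg_ne_zero.2 hα0.ne')]
  refine setLIntegral_congr_fun measurableSet_Ioi fun t (ht : 0 < t) => ?_
  simp only [Pi.mul_apply]
  rw [← mul_assoc, ← mul_assoc, ← ENNReal.ofReal_mul (abs_nonneg _),
    ← ENNReal.ofReal_mul (hf.nonneg t)]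
  congr 2
  have ht' : 0 < t ^ (-α) := Real.rpow_pos_of_pos ht _
  rw [scaledMittagLefflerPDF, if_pos ht', ← Real.rpow_mul ht.le, ← Real.rpow_mul ht.le, abs_mul,
    abs_neg, abs_of_pos hα0, abs_of_pos (Real.rpow_pos_of_pos ht _),
    show -α * (-1 / α) = 1 by field_simp, Real.rpow_one,
    show -θ = (-α - 1) + -α * ((θ - 1) / α - 1) by field_simp; ring, Real.rpow_add ht]
  field_simp

/-- The law of `S_{α,θ} * G_{θ+n,1} ^ α` is that of `W ^ α`, with `W` having the density
given by derivatives of `exp (-(w ^ α))`. -/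
lemma lintegral_scaledMittagLeffler_gamma (hα0 : 0 < α) (hα1 : α < 1) (hθ : -α < θ)
    (hf : IsPositiveStableDensity α f) {n : ℕ} (hn : n ≠ 0) {h : ℝ → ℝ≥0∞} (hh : Measurable h) :
    ∫⁻ s, ∫⁻ g, h (s * g ^ α) ∂gammaMeasure (θ + n) 1
      ∂volume.withDensity (fun s => ENNReal.ofReal (scaledMittagLefflerPDF α θ f s)) =
    ∫⁻ w in Set.Ioi 0, ENNReal.ofReal (Real.Gamma (θ + 1) / Real.Gamma (θ / α + 1) /
      Real.Gamma (θ + n) * w ^ (θ + n - 1) * expRpowDeriv α n w) * h (w ^ α) := by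
  have hn1 : (1 : ℝ) ≤ n := by exact_mod_cast Nat.one_le_iff_ne_zero.2 hn
  have hθn : 0 < θ + n := by linarith
  have h2 : 0 < θ / α + 1 := by
    rw [show θ / α + 1 = (θ + α) / α by field_simp]
    exact div_pos (by linarith) hα0
  have g2 := Real.Gamma_pos_of_pos h2
  have g3 := Real.Gamma_pos_of_pos (by linarith : 0 < θ + 1)
  have g4 := Real.Gamma_pos_of_pos hθn
  have := isFiniteMeasure_stableMeasure hf
  have := isProbabilityMeasure_gammaMeasure hθn one_pos
  have hγ : Measurable (gammaPDF (θ + n) 1) := (measurable_gammaPDFReal _ _).ennreal_ofReal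
  have hm : Measurable fun q : ℝ × ℝ => h (q.1 * q.2 ^ α) := by fun_prop
  rw [lintegral_scaledMittagLeffler hα0 hα1 hθ hf hm.lintegral_prod_right']
  set c : ℝ := Real.Gamma (θ + 1) / Real.Gamma (θ / α + 1) with hc
  have hc0 : 0 < c := div_pos g3 g2
  have key : ∀ t : ℝ, 0 < t → ENNReal.ofReal (c * t ^ (-θ)) *
      ∫⁻ g, h (t ^ (-α) * g ^ α) ∂gammaMeasure (θ + n) 1 =
      ∫⁻ w in Set.Ioi 0, ENNReal.ofReal (c / Real.Gamma (θ + n) * w ^ (θ + n - 1)) * h (w ^ α) *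
        ENNReal.ofReal (t ^ n * Real.exp (-w * t)) := by
    intro t ht
    have hm1 : Measurable fun g : ℝ => h (t ^ (-α) * g ^ α) := by fun_prop
    -- The Gamma density vanishes only on negative arguments, so the point `0` is discarded as a
    -- null set.
    have h0 : ∫⁻ g, h (t ^ (-α) * g ^ α) ∂gammaMeasure (θ + n) 1 =
        ∫⁻ g in Set.Ioi 0, gammaPDF (θ + n) 1 g * h (t ^ (-α) * g ^ α) := by
      rw [gammaMeasure, lintegral_withDensity_eq_lintegral_mul _ hγ hm1,
        ← lintegral_add_compl _ (measurableSet_Ioi (a := (0 : ℝ))), Set.compl_Ioi,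
        setLIntegral_congr Iio_ae_eq_Iic.symm,
        setLIntegral_eq_zero measurableSet_Iio fun g hg => by
          simp [gammaPDF_of_neg hg], add_zero]
      rfl
    -- The substitution `g = t * w` makes `t ^ (-α) * g ^ α` free of `t`. The Jacobian, the tilt and
    -- the Gamma density combine into `t ^ n * exp (-w * t)`.
    rw [h0, lintegral_Ioi_comp_mul_left ht, ← lintegral_const_mul _ (by fun_prop)]
    refine setLIntegral_congr_fun measurableSet_Ioi fun w (hw : 0 < w) => ?_
    have e1 : t ^ (-α) * (t * w) ^ α = w ^ α := by
      rw [Real.mul_rpow ht.le hw.le, ← mul_assoc, ← Real.rpow_add ht]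
      simp
    rw [e1, gammaPDF_of_nonneg (mul_pos ht hw).le, ← mul_assoc, ← mul_assoc,
      ← ENNReal.ofReal_mul (by positivity), ← ENNReal.ofReal_mul (by positivity),
      mul_right_comm _ (h (w ^ α)), ← ENNReal.ofReal_mul (by positivity)]
    congr 2
    have e2 : t ^ n = t ^ (-θ) * t * t ^ (θ + n - 1) := by
      rw [← Real.rpow_add_one ht.ne', ← Real.rpow_add ht, ← Real.rpow_natCast]
      congr 1; ring
    rw [e2, Real.mul_rpow ht.le hw.le, Real.one_rpow, one_mul, mul_comm t w, neg_mul]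
    field_simp
  rw [lintegral_congr_ae ((ae_stableMeasure f).mono key),
    lintegral_lintegral_swap (by fun_prop)]
  refine setLIntegral_congr_fun measurableSet_Ioi fun w (hw : 0 < w) => ?_
  rw [lintegral_const_mul _ (by fun_prop), lintegral_pow_mul_exp_stableMeasure hf n hw,
    mul_right_comm, ← ENNReal.ofReal_mul (by positivity)]

lemma lintegral_rho (hα0 : 0 < α) (hα1 : α < 1) (hθ : -α < θ) {n k : ℕ} (hn : n ≠ 0)
    (hk : k ≠ 0) :
    ∫⁻ w in Set.Ioi 0, ENNReal.ofReal (Real.Gamma (θ + 1) / Real.Gamma (θ / α + 1) /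
      Real.Gamma (θ + n) * w ^ (θ + n - 1) * expRpowDeriv α n w) *
        ENNReal.ofReal (rho k α n (w ^ α)) = ENNReal.ofReal (blockProb n k α θ) := by
  have hn1 : (1 : ℝ) ≤ n := by exact_mod_cast Nat.one_le_iff_ne_zero.2 hn
  have hk1 : (1 : ℝ) ≤ k := by exact_mod_cast Nat.one_le_iff_ne_zero.2 hk
  have hθn : 0 < θ + n := by linarith
  have h2 : 0 < θ / α + 1 := by
    rw [show θ / α + 1 = (θ + α) / α by field_simp]
    exact div_pos (by linarith) hα0
  have g2 := Real.Gamma_pos_of_pos h2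
  have g3 := Real.Gamma_pos_of_pos (by linarith : 0 < θ + 1)
  have g4 := Real.Gamma_pos_of_pos hθn
  have hC := genFactSum_nonneg n k hα0 hα1
  set c : ℝ := Real.Gamma (θ + 1) / Real.Gamma (θ / α + 1) / Real.Gamma (θ + n) with hc
  have hc0 : 0 < c := by positivity
  have hq : -1 < θ + k * α - 1 := by nlinarith
  have hI := integral_rpow_mul_exp_neg_rpow hα0 hq
  have hg : 0 < k + θ / α := by linarith
  rw [show (θ + k * α - 1 + 1) / α = k + θ / α by field_simp; ring] at hI
  have hint : Integrable (fun w : ℝ => w ^ (θ + k * α - 1) * Real.exp (-w ^ α))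
      (volume.restrict (Set.Ioi 0)) := by
    by_contra hcon
    rw [integral_undef hcon] at hI
    have := Real.Gamma_pos_of_pos hg
    exact (by positivity : (0 : ℝ) < 1 / α * Real.Gamma (k + θ / α)).ne hI
  calc _ = ∫⁻ w in Set.Ioi 0, ENNReal.ofReal (c * genFactSum n k α *
        (w ^ (θ + k * α - 1) * Real.exp (-w ^ α))) := by
        refine setLIntegral_congr_fun measurableSet_Ioi fun w (hw : 0 < w) => ?_
        have hz : 0 < w ^ α := Real.rpow_pos_of_pos hw _
        have hs := sum_genFactCoeff_mul_pow_pos hn hα0 hα1 hz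
        rw [expRpowDeriv_eq hn α hw, ← ENNReal.ofReal_mul (by positivity), rho, genFactSum_eq hn]
        congr 1
        -- After the polynomial cancels, only this power and `exp (-w ^ α)` remain, an integrand
        -- giving `Γ(k + θ / α) / α`.
        have e1 : w ^ (θ + n - 1) * (w ^ α) ^ k = w ^ n * w ^ (θ + k * α - 1) := by
          rw [← Real.rpow_natCast, ← Real.rpow_natCast, ← Real.rpow_mul hw.le,
            ← Real.rpow_add hw, ← Real.rpow_add hw]
          congr 1; ring
        have hwn : w ^ n ≠ 0 := by positivity
        field_simp
        linear_combination genFactCoeff n k α * e1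
    _ = _ := by
        rw [← ofReal_integral_eq_lintegral_ofReal (hint.const_mul _), integral_const_mul, hI]
        · congr 1
          rw [blockProb, hc]
          field_simp
        · filter_upwards [ae_restrict_mem measurableSet_Ioi] with w hw
          have : (0 : ℝ) < w := hw
          simp only [Pi.zero_apply]
          positivity

end Stable

/-! ### Independent substitution and comparison of the laws -/

section Substitution

open scoped ENNReal

/-- Substitution of an independent random element in a measurable family. -/
lemma measure_eq_lintegral_of_indepFun {Ω E F : Type*} [MeasurableSpace Ω] [MeasurableSpace E]
    [MeasurableSpace F] {μ : Measure Ω} [IsProbabilityMeasure μ] {Z : Ω → E} {Y : Ω → F}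
    (hZ : Measurable Z) (hY : Measurable Y) (hind : IndepFun Z Y μ) {A : Set (E × F)}
    (hA : MeasurableSet A) :
    μ {ω | (Z ω, Y ω) ∈ A} = ∫⁻ z, μ {ω | (z, Y ω) ∈ A} ∂μ.map Z := by
  have := Measure.isProbabilityMeasure_map hZ.aemeasurable (μ := μ)
  have := Measure.isProbabilityMeasure_map hY.aemeasurable (μ := μ)
  have h1 := (indepFun_iff_map_prod_eq_prod_map_map hZ.aemeasurable hY.aemeasurable).1 hind
  have h2 : μ {ω | (Z ω, Y ω) ∈ A} = μ.map (fun ω => (Z ω, Y ω)) A :=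
    (Measure.map_apply (hZ.prodMk hY) hA).symm
  rw [h2, h1, Measure.prod_apply hA]
  exact lintegral_congr fun z => Measure.map_apply hY (measurable_prodMk_left hA)

end Substitution

end PitmanYor

namespace PitmanYor

/-- The law of `R(α, n, S_{α,θ} * G_{θ+n,1} ^ α)`. -/
lemma measure_rhoFamily_eq {n : ℕ} (hn : n ≠ 0) {α θ : ℝ} (hα0 : 0 < α) (hα1 : α < 1)
    (hθ : -α < θ) {Ω' : Type*} {𝓡 : MeasurableSpace Ω'} [mΩ' : MeasurableSpace Ω']
    {μ' : Measure Ω'} [IsProbabilityMeasure μ']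
    {S : Ω' → ℝ} (hSm : Measurable S) (hS : HasScaledMittagLefflerLaw α θ S μ')
    {G : Ω' → ℝ} (hGm : Measurable G) (hG : HasLaw G (gammaMeasure (θ + n) 1) μ')
    {R : ℝ → Ω' → ℕ} (hR : IsRhoFamily 𝓡 α n R μ')
    (hindep : iIndep ![MeasurableSpace.comap S (borel ℝ), MeasurableSpace.comap G (borel ℝ), 𝓡] μ')
    {k : ℕ} (hk : k ∈ Finset.Icc 1 n) :
    μ' {ω | R (S ω * G ω ^ α) ω = k} = ENNReal.ofReal (blockProb n k α θ) := by
  obtain ⟨f, hf, hSlaw⟩ := hS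
  set Z : Ω' → ℝ := fun ω => S ω * G ω ^ α with hZ
  have hZm : Measurable Z := by fun_prop
  have hle : ∀ i, ![MeasurableSpace.comap S (borel ℝ), MeasurableSpace.comap G (borel ℝ), 𝓡] i
      ≤ mΩ' := by
    intro i
    fin_cases i
    · exact hSm.comap_le
    · exact hGm.comap_le
    · exact hR.le
  have hSG : IndepFun S G μ' := hindep.indep (i := 0) (j := 1) (by decide)
  have hZR : Indep (MeasurableSpace.comap Z (borel ℝ)) 𝓡 μ' := by
    -- Grouping the first two σ-algebras makes the product `Z` independent of `𝓡`.
    have h := indep_iSup_of_disjoint hle hindep (S := {0, 1}) (T := {2}) (by simp)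
    refine indep_of_indep_of_le_left (indep_of_indep_of_le_right h
      (le_iSup₂_of_le (f := fun i (_ : i ∈ ({2} : Set (Fin 3))) =>
        ![MeasurableSpace.comap S (borel ℝ), MeasurableSpace.comap G (borel ℝ), 𝓡] i)
        2 rfl le_rfl)) ?_
    set M := ⨆ i ∈ ({0, 1} : Set (Fin 3)),
      ![MeasurableSpace.comap S (borel ℝ), MeasurableSpace.comap G (borel ℝ), 𝓡] i
    have h0 : MeasurableSpace.comap S (borel ℝ) ≤ M :=
      le_iSup₂_of_le (f := fun i (_ : i ∈ ({0, 1} : Set (Fin 3))) =>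
        ![MeasurableSpace.comap S (borel ℝ), MeasurableSpace.comap G (borel ℝ), 𝓡] i)
        0 (by simp) le_rfl
    have h1 : MeasurableSpace.comap G (borel ℝ) ≤ M :=
      le_iSup₂_of_le (f := fun i (_ : i ∈ ({0, 1} : Set (Fin 3))) =>
        ![MeasurableSpace.comap S (borel ℝ), MeasurableSpace.comap G (borel ℝ), 𝓡] i)
        1 (by simp) le_rfl
    have hS' : Measurable[M] S := Measurable.of_comap_le h0
    have hG' : Measurable[M] G := Measurable.of_comap_le h1
    have hZ' : Measurable[M] Z := hS'.mul (hG'.pow_const α)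
    exact hZ'.comap_le
  have hA : @MeasurableSet (ℝ × Ω') (Real.measurableSpace.prod 𝓡) {q | R q.1 q.2 = k} :=
    hR.measurable (measurableSet_singleton k)
  -- The whole family enters as one random element, the identity into `Ω'` with the smaller
  -- σ-algebra `𝓡`.
  have hind : @IndepFun Ω' ℝ Ω' mΩ' Real.measurableSpace 𝓡 Z id μ' := by
    refine (@IndepFun_iff_Indep Ω' ℝ Ω' mΩ' Real.measurableSpace 𝓡 Z id μ').2 ?_
    rw [MeasurableSpace.comap_id]
    exact hZR
  have hid : @Measurable Ω' Ω' mΩ' 𝓡 id := measurable_id'' hR.le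
  have h1 : μ' {ω | R (Z ω) ω = k} = ∫⁻ z, μ' {ω | R z ω = k} ∂μ'.map Z :=
    @measure_eq_lintegral_of_indepFun Ω' ℝ Ω' mΩ' Real.measurableSpace 𝓡 μ' _ Z id hZm hid hind
      {q | R q.1 q.2 = k} hA
  have hh : Measurable fun z => μ' {ω | R z ω = k} :=
    @measurable_measure_prodMk_left ℝ Ω' Real.measurableSpace mΩ' μ' _ {q | R q.1 q.2 = k}
      ((hR.measurable.mono (sup_le_sup le_rfl (MeasurableSpace.comap_mono hR.le)) le_rfl)
        (measurableSet_singleton k))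
  have hn1 : (1 : ℝ) ≤ n := by exact_mod_cast Nat.one_le_iff_ne_zero.2 hn
  have := isProbabilityMeasure_gammaMeasure (by linarith : 0 < θ + n) one_pos
  have hSp := hSlaw.isProbabilityMeasure_iff.1 inferInstance
  have h2 := (indepFun_iff_map_prod_eq_prod_map_map hSm.aemeasurable hGm.aemeasurable).1 hSG
  rw [hSlaw.map_eq, hG.map_eq] at h2
  have hm : Measurable fun q : ℝ × ℝ => q.1 * q.2 ^ α := by fun_prop
  have h3 : μ'.map Z = (μ'.map fun ω => (S ω, G ω)).map fun q => q.1 * q.2 ^ α :=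
    (Measure.map_map hm (hSm.prodMk hGm)).symm
  have hk' := Finset.mem_Icc.1 hk
  rw [h1, h3, h2, lintegral_map hh hm, lintegral_prod (fun q : ℝ × ℝ => μ' {ω | R (q.1 * q.2 ^ α) ω = k}) (hh.comp hm).aemeasurable,
    lintegral_scaledMittagLeffler_gamma hα0 hα1 hθ hf hn hh,
    ← lintegral_rho hα0 hα1 hθ hn (by omega : k ≠ 0)]
  refine setLIntegral_congr_fun measurableSet_Ioi fun w (hw : 0 < w) => ?_
  rw [← hR.law _ (Real.rpow_pos_of_pos hw _) k hk, ofReal_measureReal]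

lemma numBlocks_mem_Icc {n : ℕ} (hn : 1 ≤ n) {Ω : Type*} (X : Fin n → Ω → ℕ) (ω : Ω) :
    numBlocks X ω ∈ Finset.Icc 1 n := by
  have : Nonempty (Fin n) := ⟨⟨0, hn⟩⟩
  rw [Finset.mem_Icc]
  refine ⟨Finset.card_pos.2 (Finset.univ_nonempty.image _), ?_⟩
  exact Finset.card_image_le.trans (by simp)

/-- Two probability measures that agree on singletons of a finite set carrying one of them are
equal. -/
lemma eq_of_apply_singleton_eq {ν ν' : Measure ℕ} [IsProbabilityMeasure ν]
    [IsProbabilityMeasure ν'] (s : Finset ℕ) (hs : ν (s : Set ℕ)ᶜ = 0)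
    (h : ∀ k ∈ s, ν {k} = ν' {k}) : ν = ν' := by
  have h1 : ν s = ν' s := by
    rw [← sum_measure_singleton, ← sum_measure_singleton]
    exact Finset.sum_congr rfl h
  have h2 : ν' (s : Set ℕ)ᶜ = 0 := by
    rw [prob_compl_eq_zero_iff s.measurableSet, ← h1]
    exact (prob_compl_eq_zero_iff s.measurableSet).1 hs
  refine Measure.ext_of_singleton fun k => ?_
  by_cases hk : k ∈ s
  · exact h k hk
  · rw [measure_mono_null (by simpa using hk) hs, measure_mono_null (by simpa using hk) h2]

end PitmanYor

open PitmanYor in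
theorem proposition2p2 (n : ℕ) (hn : 1 ≤ n) (α θ : ℝ) (hα0 : 0 < α) (hα1 : α < 1) (hθ : -α < θ)
    -- a random sample of size n from PD(α, θ)
    {Ω : Type*} [MeasurableSpace Ω] (μ : Measure Ω) [IsProbabilityMeasure μ]
    (P : Ω → ℕ → ℝ) (hP : HasLaw P (poissonDirichlet α θ) μ)
    (X : Fin n → Ω → ℕ) (hX : IsRandomSample X P μ)
    -- independent S, G and R
    {Ω' : Type*} (𝓡 : MeasurableSpace Ω') [MeasurableSpace Ω']
    (μ' : Measure Ω') [IsProbabilityMeasure μ']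
    (S : Ω' → ℝ) (hSm : Measurable S) (hS : HasScaledMittagLefflerLaw α θ S μ')
    (G : Ω' → ℝ) (hGm : Measurable G) (hG : HasLaw G (gammaMeasure (θ + n) 1) μ')
    (R : ℝ → Ω' → ℕ) (hR : IsRhoFamily 𝓡 α n R μ')
    (hindep : iIndep ![MeasurableSpace.comap S (borel ℝ), MeasurableSpace.comap G (borel ℝ), 𝓡] μ') :
    IdentDistrib (numBlocks X) (fun ω => R (S ω * G ω ^ α) ω) μ μ' := by
  have hn0 : n ≠ 0 := by omega
  have hXm : Measurable (numBlocks X) :=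
    (Measurable.of_discrete (f := fun x : Fin n → ℕ => (Finset.univ.image x).card)).comp
      (measurable_pi_lambda _ hX.measurable)
  have hid := hR.measurable.mono
    (sup_le_sup le_rfl (MeasurableSpace.comap_mono hR.le)) le_rfl
  have hRm : Measurable fun ω => R (S ω * G ω ^ α) ω :=
    hid.comp ((by fun_prop : Measurable fun ω => S ω * G ω ^ α).prodMk measurable_id)
  refine ⟨hXm.aemeasurable, hRm.aemeasurable, ?_⟩
  have := Measure.isProbabilityMeasure_map hXm.aemeasurable (μ := μ)
  have := Measure.isProbabilityMeasure_map hRm.aemeasurable (μ := μ')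
  -- The block count always lies in this range, and both laws have mass one, so agreement there
  -- leaves no mass elsewhere for `R`.
  refine eq_of_apply_singleton_eq (Finset.Icc 1 n) ?_ fun k hk => ?_
  · rw [Measure.map_apply hXm (Finset.measurableSet _).compl]
    convert! measure_empty (μ := μ)
    ext ω
    have := numBlocks_mem_Icc hn X ω
    simpa using this
  · rw [Measure.map_apply hXm (measurableSet_singleton k),
      Measure.map_apply hRm (measurableSet_singleton k)]
    exact (measure_numBlocks_eq hn0 hα0 hα1 hθ hP hX k).trans
      (measure_rhoFamily_eq hn0 hα0 hα1 hθ hSm hS hGm hG hR hindep hk).symm
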